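/- **Theorem (the local Galois groupoid).** Let $q\in\mathbf{C}^*$ with $|q|>1$, let $\mathbf{C}(\{z\})$ be the field of germs at $0$ of meromorphic functions, and let $\sigma_q f(z)=f(qz)$. Let $\mathcal{P}^{(0)}$ be the category whose objects are the pairs $(\mathbf{C}^n,A)$ with $n\in\mathbf{N}$, $A\in GL_n(\mathbf{C})$, and whose morphisms $(\mathbf{C}^n,A)\to(\mathbf{C}^p,B)$ are the matrices $F\in M_{p,n}(\mathbf{C}(\{z\}))$ such that $(\sigma_qF)A=BF$; composition is the product of matrices, the tensor product is $(\mathbf{C}^n,A)\otimes(\mathbf{C}^m,B)=(\mathbf{C}^{nm},A\otimes B)$ with the Kronecker product of matrices, and the unit is $(\mathbf{C},1)$. The entries of such an $F$ extend uniquely to holomorphic functions on $\mathbf{C}^*$; for $z_0\in\mathbf{C}^*$ let $\omega^{(0)}_{z_0}$ be the tensor functor $(\mathbf{C}^n,A)\mapsto\mathbf{C}^n$, $F\mapsto F(z_0)$ from $\mathcal{P}^{(0)}$ to finite dimensional complex vector spaces. Let $\mathcal{R}=Rep_{\mathbf{C}}(\mathbf{Z})$ be the tensor category with the same objects and tensor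 product, but with only the constant morphisms $F\in M_{p,n}(\mathbf{C})$, $FA=BF$, and let $\omega$ be its forgetful functor $(\mathbf{C}^n,A)\mapsto\mathbf{C}^n$, $F\mapsto F$. Every $\omega^{(0)}_{z_0}$ restricts to $\omega$ on $\mathcal{R}$. Write $Aut^{\otimes}$ and $Iso^{\otimes}$ for natural automorphisms and isomorphisms compatible with tensor products and units. Let $\mathbf{Z}^{alg}=Hom_{grp}(\mathbf{C}^*,\mathbf{C}^*)\times\mathbf{C}$. For $A\in GL_n(\mathbf{C})$ write $A=A_sA_u=A_uA_s$ with $A_s=Q\,\mathrm{diag}(c_1,\dots,c_n)\,Q^{-1}$ and $A_u$ unipotent, and for $(\gamma,\lambda)\in\mathbf{Z}^{alg}$ put $$A^{(\gamma,\lambda)}=\gamma(A_s)A_u^{\lambda},\qquad \gamma(A_s)=Q\,\mathrm{diag}(\gamma(c_1),\dots,\gamma(c_n))\,Q^{-1},\qquad A_u^\lambda=\sum_{k\ge 0}\binom{\lambda}{k}(A_u-I_n)^k .$$ Then $A^{(\gamma,\lambda)}$ does not depend on the choices, and letting $(\gamma,\lambda)$ act on $\omega(\mathbf{C}^n,A)=\mathbf{C}^n$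 by $A^{(\gamma,\lambda)}$ defines an isomorphism of groups $\mathbf{Z}^{alg}\to Aut^{\otimes}(\omega)$. For all $z_0,z_1\in\mathbf{C}^*$, restriction to $\mathcal{R}$ is an injection $Iso^{\otimes}(\omega^{(0)}_{z_0},\omega^{(0)}_{z_1})\to Aut^{\otimes}(\omega)$, and, with the identification of $Aut^{\otimes}(\omega)$ with $\mathbf{Z}^{alg}$ above, its image is $$Iso^{\otimes}(\omega^{(0)}_{z_0},\omega^{(0)}_{z_1})=\{(\gamma,\lambda)\in\mathbf{Z}^{alg}\;/\;\gamma(q)z_0=z_1\}.$$ -/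

import Mathlib

namespace LocalGalois

open CategoryTheory MonoidalCategory
open scoped Kronecker

section MatrixCategory

variable {K : Type} [CommRing K]

/-- Kronecker product of matrices, the product of two index sets `Fin n × Fin n'` being
identified with `Fin (n * n')` by the lexicographic order. -/
def kron {p n p' n' : ℕ} (F : Matrix (Fin p) (Fin n) K) (G : Matrix (Fin p') (Fin n') K) :
    Matrix (Fin (p * p')) (Fin (n * n')) K :=
  (F ⊗ₖ G).submatrix finProdFinEquiv.symm finProdFinEquiv.symm

lemma kron_mul {p n m p' n' m' : ℕ} (F : Matrix (Fin p) (Fin n) K) (G : Matrix (Fin p') (Fin n') K)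
    (F₁ : Matrix (Fin n) (Fin m) K) (G₁ : Matrix (Fin n') (Fin m') K) :
    kron F G * kron F₁ G₁ = kron (F * F₁) (G * G₁) := by
  simp only [kron, Matrix.submatrix_mul_equiv, Matrix.mul_kronecker_mul]

lemma kron_one (n m : ℕ) : kron (1 : Matrix (Fin n) (Fin n) K) (1 : Matrix (Fin m) (Fin m) K) = 1 := by
  simp only [kron, Matrix.one_kronecker_one, Matrix.submatrix_one_equiv]

lemma kron_map {L : Type} [CommRing L] {p n p' n' : ℕ} (F : Matrix (Fin p) (Fin n) K)
    (G : Matrix (Fin p') (Fin n') K) (f : K →+* L) :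
    (kron F G).map f = kron (F.map f) (G.map f) := by
  ext i j
  simp [kron]

/-- The matrix of the linear map that permutes (renames) the standard basis by `e`. -/
def permMat (K : Type) [CommRing K] {n m : ℕ} (e : Fin n ≃ Fin m) : Matrix (Fin m) (Fin n) K :=
  (1 : Matrix (Fin m) (Fin m) K).submatrix id e

lemma permMat_mul {n m p : ℕ} (e : Fin n ≃ Fin m) (M : Matrix (Fin n) (Fin p) K) :
    permMat K e * M = M.submatrix e.symm id := by
  ext i j
  simp [permMat, Matrix.mul_apply, Matrix.one_apply, ← Equiv.symm_apply_eq]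

lemma mul_permMat {n m p : ℕ} (e : Fin n ≃ Fin m) (M : Matrix (Fin p) (Fin m) K) :
    M * permMat K e = M.submatrix id e := by
  ext i j
  simp [permMat, Matrix.mul_apply, Matrix.one_apply]

lemma permMat_mul_permMat {n m p : ℕ} (e : Fin n ≃ Fin m) (e' : Fin m ≃ Fin p) :
    permMat K e' * permMat K e = permMat K (e.trans e') := by
  rw [mul_permMat]; rfl

lemma permMat_refl (n : ℕ) : permMat K (Equiv.refl (Fin n)) = 1 := rfl

lemma permMat_map {L : Type} [CommRing L] {n m : ℕ} (e : Fin n ≃ Fin m) (f : K →+* L) :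
    (permMat K e).map f = permMat L e := by
  ext i j
  simp [permMat, Matrix.one_apply, apply_ite f]

/-- The identification of the index sets of `(K^a ⊗ K^b) ⊗ K^c` and of `K^a ⊗ (K^b ⊗ K^c)`. -/
def assocEquiv (a b c : ℕ) : Fin (a * b * c) ≃ Fin (a * (b * c)) :=
  finProdFinEquiv.symm.trans <| (finProdFinEquiv.symm.prodCongr (Equiv.refl _)).trans <|
    (Equiv.prodAssoc _ _ _).trans <| ((Equiv.refl _).prodCongr finProdFinEquiv).trans finProdFinEquiv

/-- The identification of the index sets of `K ⊗ K^a` and of `K^a`. -/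
def leftEquiv (a : ℕ) : Fin (1 * a) ≃ Fin a :=
  finProdFinEquiv.symm.trans (Equiv.uniqueProd (Fin a) (Fin 1))

/-- The identification of the index sets of `K^a ⊗ K` and of `K^a`. -/
def rightEquiv (a : ℕ) : Fin (a * 1) ≃ Fin a :=
  finProdFinEquiv.symm.trans (Equiv.prodUnique (Fin a) (Fin 1))

lemma kron_permMat_one {n m : ℕ} (e : Fin n ≃ Fin m) (c : ℕ) :
    kron (permMat K e) (1 : Matrix (Fin c) (Fin c) K) =
      permMat K (finProdFinEquiv.symm.trans ((e.prodCongr (Equiv.refl _)).trans finProdFinEquiv)) := by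
  ext i j
  obtain ⟨⟨i, i'⟩, rfl⟩ := finProdFinEquiv.surjective i
  obtain ⟨⟨j, j'⟩, rfl⟩ := finProdFinEquiv.surjective j
  simp only [kron, permMat, Matrix.submatrix_apply, Equiv.symm_apply_apply,
    Matrix.kroneckerMap_apply, Matrix.one_apply, Equiv.trans_apply, Equiv.prodCongr_apply,
    Prod.map_apply, id, EmbeddingLike.apply_eq_iff_eq, Prod.mk.injEq, Equiv.refl_apply]
  split_ifs <;> simp_all

lemma kron_one_permMat {n m : ℕ} (e : Fin n ≃ Fin m) (c : ℕ) :
    kron (1 : Matrix (Fin c) (Fin c) K) (permMat K e) =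
      permMat K (finProdFinEquiv.symm.trans (((Equiv.refl _).prodCongr e).trans finProdFinEquiv)) := by
  ext i j
  obtain ⟨⟨i, i'⟩, rfl⟩ := finProdFinEquiv.surjective i
  obtain ⟨⟨j, j'⟩, rfl⟩ := finProdFinEquiv.surjective j
  simp only [kron, permMat, Matrix.submatrix_apply, Equiv.symm_apply_apply,
    Matrix.kroneckerMap_apply, Matrix.one_apply, Equiv.trans_apply, Equiv.prodCongr_apply,
    Prod.map_apply, id, EmbeddingLike.apply_eq_iff_eq, Prod.mk.injEq, Equiv.refl_apply]
  split_ifs <;> simp_all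

lemma assoc_natural {p n p' n' p'' n'' : ℕ} (F : Matrix (Fin p) (Fin n) K)
    (G : Matrix (Fin p') (Fin n') K) (H : Matrix (Fin p'') (Fin n'') K) :
    permMat K (assocEquiv p p' p'') * kron (kron F G) H =
      kron F (kron G H) * permMat K (assocEquiv n n' n'') := by
  rw [permMat_mul, mul_permMat]
  ext i j
  simp [kron, assocEquiv, mul_assoc]

lemma left_natural {p n : ℕ} (F : Matrix (Fin p) (Fin n) K) :
    permMat K (leftEquiv p) * kron (1 : Matrix (Fin 1) (Fin 1) K) F =
      F * permMat K (leftEquiv n) := by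
  rw [permMat_mul, mul_permMat]
  ext i j
  simp [kron, leftEquiv, Subsingleton.elim 0 j.divNat]

lemma right_natural {p n : ℕ} (F : Matrix (Fin p) (Fin n) K) :
    permMat K (rightEquiv p) * kron F (1 : Matrix (Fin 1) (Fin 1) K) =
      F * permMat K (rightEquiv n) := by
  rw [permMat_mul, mul_permMat]
  ext i j
  simp [kron, rightEquiv, Subsingleton.elim 0 j.modNat]

/-- The category of the vector spaces (free modules) `K^n`, `n ∈ ℕ`. -/
structure MatCat (K : Type) where
  /-- the dimension `n` -/
  dim : ℕ

/-- A morphism `K^n → K^p` is a `p × n` matrix, and composition is the product of matrices. -/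
instance : Category (MatCat K) where
  Hom V W := Matrix (Fin W.dim) (Fin V.dim) K
  id V := (1 : Matrix (Fin V.dim) (Fin V.dim) K)
  comp {U V W} (F : Matrix (Fin V.dim) (Fin U.dim) K) (G : Matrix (Fin W.dim) (Fin V.dim) K) := G * F
  id_comp _ := Matrix.mul_one _
  comp_id _ := Matrix.one_mul _
  assoc _ _ _ := (Matrix.mul_assoc _ _ _).symm

lemma matCat_id (V : MatCat K) : 𝟙 V = (1 : Matrix (Fin V.dim) (Fin V.dim) K) := rfl

lemma matCat_comp {U V W : MatCat K} (F : U ⟶ V) (G : V ⟶ W) :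
    F ≫ G = (show Matrix (Fin W.dim) (Fin V.dim) K from G) *
      (show Matrix (Fin V.dim) (Fin U.dim) K from F) := rfl

/-- The isomorphism given by a permutation matrix. -/
def permIso {V W : MatCat K} (e : Fin V.dim ≃ Fin W.dim) : V ≅ W where
  hom := permMat K e
  inv := permMat K e.symm
  hom_inv_id := by rw [matCat_comp, permMat_mul_permMat, Equiv.self_trans_symm]; rfl
  inv_hom_id := by rw [matCat_comp, permMat_mul_permMat, Equiv.symm_trans_self]; rfl

/-- The tensor product: `K^n ⊗ K^m = K^(nm)`, with the Kronecker product of matrices. -/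
instance : MonoidalCategoryStruct (MatCat K) where
  tensorObj V W := ⟨V.dim * W.dim⟩
  tensorUnit := ⟨1⟩
  tensorHom F G := kron F G
  whiskerLeft V _ _ G := kron (1 : Matrix (Fin V.dim) (Fin V.dim) K) G
  whiskerRight F W := kron F (1 : Matrix (Fin W.dim) (Fin W.dim) K)
  associator U V W := permIso (assocEquiv U.dim V.dim W.dim)
  leftUnitor V := permIso (leftEquiv V.dim)
  rightUnitor V := permIso (rightEquiv V.dim)

lemma pentagon_aux (a b c d : ℕ) :
    kron (1 : Matrix (Fin a) (Fin a) K) (permMat K (assocEquiv b c d)) *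
      permMat K (assocEquiv a (b * c) d) * kron (permMat K (assocEquiv a b c)) (1 : Matrix (Fin d) (Fin d) K) =
    permMat K (assocEquiv a b (c * d)) * permMat K (assocEquiv (a * b) c d) := by
  rw [kron_one_permMat, kron_permMat_one, permMat_mul_permMat, permMat_mul_permMat,
    permMat_mul_permMat]
  congr 1
  ext i : 1
  simp [assocEquiv]

lemma triangle_aux (a b : ℕ) :
    kron (1 : Matrix (Fin a) (Fin a) K) (permMat K (leftEquiv b)) * permMat K (assocEquiv a 1 b) =
    kron (permMat K (rightEquiv a)) (1 : Matrix (Fin b) (Fin b) K) := by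
  rw [kron_one_permMat, kron_permMat_one, permMat_mul_permMat]
  congr 1
  ext i : 1
  simp [assocEquiv, leftEquiv, rightEquiv]

lemma strict_assoc_aux (a b c : ℕ) :
    permMat K (assocEquiv a b c) * (1 : Matrix (Fin (a * b * c)) (Fin (a * b * c)) K) *
      kron (1 : Matrix (Fin (a * b)) (Fin (a * b)) K) (1 : Matrix (Fin c) (Fin c) K) =
    (1 : Matrix (Fin (a * (b * c))) (Fin (a * (b * c))) K) *
      kron (1 : Matrix (Fin a) (Fin a) K) (1 : Matrix (Fin (b * c)) (Fin (b * c)) K) *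
      permMat K (assocEquiv a b c) := by
  simp only [kron_one, Matrix.mul_one, Matrix.one_mul]

lemma strict_left_aux (a : ℕ) :
    permMat K (leftEquiv a) = permMat K (leftEquiv a) *
      (1 : Matrix (Fin (1 * a)) (Fin (1 * a)) K) *
      kron (1 : Matrix (Fin 1) (Fin 1) K) (1 : Matrix (Fin a) (Fin a) K) := by
  simp only [kron_one, Matrix.mul_one]

lemma strict_right_aux (a : ℕ) :
    permMat K (rightEquiv a) = permMat K (rightEquiv a) *
      (1 : Matrix (Fin (a * 1)) (Fin (a * 1)) K) *
      kron (1 : Matrix (Fin a) (Fin a) K) (1 : Matrix (Fin 1) (Fin 1) K) := by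
  simp only [kron_one, Matrix.mul_one]

instance : MonoidalCategory (MatCat K) :=
  MonoidalCategory.ofTensorHom
    (id_tensorHom_id := fun V W => kron_one V.dim W.dim)
    (id_tensorHom := fun _ _ _ _ => rfl)
    (tensorHom_id := fun _ _ => rfl)
    (tensorHom_comp_tensorHom := fun _ _ _ _ => kron_mul _ _ _ _)
    (associator_naturality := fun _ _ _ => assoc_natural _ _ _)
    (leftUnitor_naturality := fun F => left_natural F)
    (rightUnitor_naturality := fun F => right_natural F)
    (pentagon := fun _ _ _ _ => pentagon_aux _ _ _ _)
    (triangle := fun _ _ => triangle_aux _ _)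

end MatrixCategory

section FlatSystems

variable {K : Type} [CommRing K] [Algebra ℂ K] {σ : K →ₐ[ℂ] K}

/-- A complex matrix seen as a (constant) matrix over the function ring `K`. -/
def constMat (K : Type) [CommRing K] [Algebra ℂ K] {p n : ℕ} (A : Matrix (Fin p) (Fin n) ℂ) :
    Matrix (Fin p) (Fin n) K :=
  A.map (algebraMap ℂ K)

/-- Flat (constant coefficient) difference systems `(ℂ^n, A)`, `A ∈ GL_n(ℂ)`, i.e. the systems
`σ X = A X`, over the difference ring `(K, σ)`. -/
structure FlatSys (K : Type) [CommRing K] [Algebra ℂ K] (σ : K →ₐ[ℂ] K) where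
  /-- the rank `n` -/
  rank : ℕ
  /-- the invertible matrix `A` -/
  A : GL (Fin rank) ℂ

/-- A morphism `(ℂ^n, A) → (ℂ^p, B)` is a matrix `F ∈ M_{p,n}(K)` with `(σ F) A = B F`. -/
@[ext]
structure FlatSys.Hom (X Y : FlatSys K σ) where
  /-- the matrix `F` -/
  mat : Matrix (Fin Y.rank) (Fin X.rank) K
  comm : mat.map σ * constMat K X.A.val = constMat K Y.A.val * mat

lemma constMat_mul {p n m : ℕ} (A : Matrix (Fin p) (Fin n) ℂ) (B : Matrix (Fin n) (Fin m) ℂ) :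
    constMat K (A * B) = constMat K A * constMat K B := Matrix.map_mul

lemma constMat_one (n : ℕ) : constMat K (1 : Matrix (Fin n) (Fin n) ℂ) = 1 :=
  Matrix.map_one _ (map_zero _) (map_one _)

lemma constMat_kron {p n p' n' : ℕ} (A : Matrix (Fin p) (Fin n) ℂ) (B : Matrix (Fin p') (Fin n') ℂ) :
    constMat K (kron A B) = kron (constMat K A) (constMat K B) := kron_map _ _ _

lemma constMat_map {p n : ℕ} (A : Matrix (Fin p) (Fin n) ℂ) (σ : K →ₐ[ℂ] K) :
    (constMat K A).map σ = constMat K A := by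
  ext i j
  simp [constMat]

lemma one_map_alg (n : ℕ) (σ : K →ₐ[ℂ] K) : (1 : Matrix (Fin n) (Fin n) K).map σ = 1 :=
  Matrix.map_one _ (map_zero _) (map_one _)

/-- The category of flat systems; composition is the product of matrices. -/
instance : Category (FlatSys K σ) where
  Hom X Y := FlatSys.Hom X Y
  id X := ⟨1, by rw [one_map_alg, Matrix.one_mul, Matrix.mul_one]⟩
  comp {X Y Z} F G := ⟨G.mat * F.mat, by
    rw [Matrix.map_mul, Matrix.mul_assoc, F.comm, ← Matrix.mul_assoc, G.comm, Matrix.mul_assoc]⟩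
  id_comp _ := FlatSys.Hom.ext (Matrix.mul_one _)
  comp_id _ := FlatSys.Hom.ext (Matrix.one_mul _)
  assoc _ _ _ := FlatSys.Hom.ext (Matrix.mul_assoc _ _ _).symm

/-- The matrix of a morphism of flat systems. -/
abbrev FlatSys.matrix {X Y : FlatSys K σ} (F : X ⟶ Y) : Matrix (Fin Y.rank) (Fin X.rank) K :=
  FlatSys.Hom.mat F

lemma flatSys_ext {X Y : FlatSys K σ} {F G : X ⟶ Y}
    (h : FlatSys.matrix F = FlatSys.matrix G) : F = G := FlatSys.Hom.ext h

/-- The tensor product of invertible matrices is invertible. -/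
def kronGL {n m : ℕ} (A : GL (Fin n) ℂ) (B : GL (Fin m) ℂ) : GL (Fin (n * m)) ℂ where
  val := kron A.val B.val
  inv := kron A.inv B.inv
  val_inv := by rw [kron_mul, A.val_inv, B.val_inv, kron_one]
  inv_val := by rw [kron_mul, A.inv_val, B.inv_val, kron_one]

/-- Forgetting the matrix `A`: the functor `(ℂ^n, A) ↦ K^n`, `F ↦ F`. -/
def toMat (K : Type) [CommRing K] [Algebra ℂ K] (σ : K →ₐ[ℂ] K) : FlatSys K σ ⥤ MatCat K where
  obj X := ⟨X.rank⟩
  map F := FlatSys.matrix F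
  map_id _ := rfl
  map_comp _ _ := rfl

/-- The tensor product of two morphisms. -/
def FlatSys.Hom.tensor {X Y X' Y' : FlatSys K σ} (F : FlatSys.Hom X Y) (G : FlatSys.Hom X' Y') :
    FlatSys.Hom (σ := σ) ⟨X.rank * X'.rank, kronGL X.A X'.A⟩ ⟨Y.rank * Y'.rank, kronGL Y.A Y'.A⟩ where
  mat := kron F.mat G.mat
  comm := by
    have h : (kron F.mat G.mat).map σ = kron (F.mat.map σ) (G.mat.map σ) :=
      kron_map _ _ (σ : K →+* K)
    rw [h]
    simp only [kronGL, constMat_kron, kron_mul, F.comm, G.comm]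

/-- A permutation of bases that is compatible with the matrices is an isomorphism. -/
def FlatSys.permIso {X Y : FlatSys K σ} (e : Fin X.rank ≃ Fin Y.rank)
    (h : permMat ℂ e * X.A.val = Y.A.val * permMat ℂ e) : X ≅ Y where
  hom := FlatSys.Hom.mk (permMat K e) (by
    have h1 : (permMat K e).map σ = permMat K e := permMat_map e (σ : K →+* K)
    have h2 : constMat K (permMat ℂ e) = permMat K e := permMat_map e (algebraMap ℂ K)
    rw [h1, ← h2, ← constMat_mul, ← constMat_mul, h])
  inv := FlatSys.Hom.mk (permMat K e.symm) (by
    have h1 : (permMat K e.symm).map σ = permMat K e.symm := permMat_map e.symm (σ : K →+* K)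
    have h2 : constMat K (permMat ℂ e.symm) = permMat K e.symm :=
      permMat_map e.symm (algebraMap ℂ K)
    have h3 : permMat ℂ e.symm * Y.A.val = X.A.val * permMat ℂ e.symm := by
      have h4 : permMat ℂ e.symm * (permMat ℂ e * X.A.val) * permMat ℂ e.symm =
          permMat ℂ e.symm * (Y.A.val * permMat ℂ e) * permMat ℂ e.symm := by rw [h]
      rw [← Matrix.mul_assoc, permMat_mul_permMat, Equiv.self_trans_symm, permMat_refl,
        Matrix.one_mul, Matrix.mul_assoc, Matrix.mul_assoc, permMat_mul_permMat,
        Equiv.symm_trans_self, permMat_refl, Matrix.mul_one] at h4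
      exact h4.symm
    rw [h1, ← h2, ← constMat_mul, ← constMat_mul, h3])
  hom_inv_id := flatSys_ext (by
    change permMat K e.symm * permMat K e = 1
    rw [permMat_mul_permMat, Equiv.self_trans_symm, permMat_refl])
  inv_hom_id := flatSys_ext (by
    change permMat K e * permMat K e.symm = 1
    rw [permMat_mul_permMat, Equiv.symm_trans_self, permMat_refl])

/-- `(ℂ^n, A) ⊗ (ℂ^m, B) = (ℂ^(nm), A ⊗ B)`, the tensor product of morphisms is that of
their matrices, and the unit is `(ℂ, 1)`. -/
instance : MonoidalCategoryStruct (FlatSys K σ) where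
  tensorObj X Y := ⟨X.rank * Y.rank, kronGL X.A Y.A⟩
  tensorUnit := ⟨1, 1⟩
  tensorHom F G := FlatSys.Hom.tensor F G
  whiskerLeft X _ _ G := FlatSys.Hom.tensor (𝟙 X) G
  whiskerRight F Y := FlatSys.Hom.tensor F (𝟙 Y)
  associator X Y Z := FlatSys.permIso (assocEquiv X.rank Y.rank Z.rank)
    (assoc_natural X.A.val Y.A.val Z.A.val)
  leftUnitor X := FlatSys.permIso (leftEquiv X.rank) (left_natural X.A.val)
  rightUnitor X := FlatSys.permIso (rightEquiv X.rank) (right_natural X.A.val)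

instance : MonoidalCategory (FlatSys K σ) :=
  MonoidalCategory.ofTensorHom
    (id_tensorHom_id := fun X Y => flatSys_ext (kron_one X.rank Y.rank))
    (id_tensorHom := fun _ _ _ _ => rfl)
    (tensorHom_id := fun _ _ => rfl)
    (tensorHom_comp_tensorHom := fun _ _ _ _ => flatSys_ext (kron_mul _ _ _ _))
    (associator_naturality := fun _ _ _ => flatSys_ext (assoc_natural _ _ _))
    (leftUnitor_naturality := fun F => flatSys_ext (left_natural F.mat))
    (rightUnitor_naturality := fun F => flatSys_ext (right_natural F.mat))
    (pentagon := fun _ _ _ _ => flatSys_ext (pentagon_aux _ _ _ _))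
    (triangle := fun _ _ => flatSys_ext (triangle_aux _ _))

/-- `toMat` is a tensor functor, with identities as structural isomorphisms. -/
instance : (toMat K σ).Monoidal := Functor.CoreMonoidal.toMonoidal
  { εIso := Iso.refl _
    μIso := fun _ _ => Iso.refl _
    μIso_hom_natural_left := fun _ _ => (Category.comp_id _).trans (Category.id_comp _).symm
    μIso_hom_natural_right := fun _ _ => (Category.comp_id _).trans (Category.id_comp _).symm
    associativity := fun X Y Z => strict_assoc_aux X.rank Y.rank Z.rank
    left_unitality := fun X => strict_left_aux X.rank
    right_unitality := fun X => strict_right_aux X.rank }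

end FlatSystems

section Germs
open Filter Topology

/-- The ring `ℂ({z})` of germs at `0` of meromorphic functions (germs of functions on punctured
neighbourhoods of `0`). -/
def MeroGerm : Subring (Germ (𝓝[≠] (0 : ℂ)) ℂ) where
  carrier := {g | ∃ f : ℂ → ℂ, MeromorphicAt f 0 ∧ (f : Germ (𝓝[≠] (0 : ℂ)) ℂ) = g}
  mul_mem' := by
    rintro _ _ ⟨f, hf, rfl⟩ ⟨g, hg, rfl⟩
    exact ⟨f * g, hf.mul hg, rfl⟩
  one_mem' := ⟨fun _ => 1, MeromorphicAt.const 1 0, rfl⟩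
  add_mem' := by
    rintro _ _ ⟨f, hf, rfl⟩ ⟨g, hg, rfl⟩
    exact ⟨f + g, hf.add hg, rfl⟩
  zero_mem' := ⟨fun _ => 0, MeromorphicAt.const 0 0, rfl⟩
  neg_mem' := by
    rintro _ ⟨f, hf, rfl⟩
    exact ⟨-f, hf.neg, rfl⟩

/-- The constants as germs. -/
noncomputable def constGerm : ℂ →+* MeroGerm where
  toFun c := ⟨((fun _ : ℂ => c : ℂ → ℂ) : Germ (𝓝[≠] (0 : ℂ)) ℂ), _, MeromorphicAt.const c 0, rfl⟩
  map_one' := rfl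
  map_zero' := rfl
  map_mul' _ _ := rfl
  map_add' _ _ := rfl

noncomputable instance : Algebra ℂ MeroGerm := constGerm.toAlgebra

lemma tendsto_mul_punctured (q : ℂˣ) :
    Tendsto (fun z : ℂ => (q : ℂ) * z) (𝓝[≠] 0) (𝓝[≠] 0) := by
  refine tendsto_nhdsWithin_iff.2 ⟨?_, ?_⟩
  · have : Tendsto (fun z : ℂ => (q : ℂ) * z) (𝓝 0) (𝓝 ((q : ℂ) * 0)) :=
      (continuous_const.mul continuous_id).tendsto 0
    rw [mul_zero] at this
    exact this.mono_left nhdsWithin_le_nhds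
  · filter_upwards [self_mem_nhdsWithin] with z hz
    exact mul_ne_zero q.ne_zero hz

lemma meroGerm_comp_mem (q : ℂˣ) {g : Germ (𝓝[≠] (0 : ℂ)) ℂ} (hg : g ∈ MeroGerm) :
    g.compTendsto _ (tendsto_mul_punctured q) ∈ MeroGerm := by
  obtain ⟨f, hf, rfl⟩ := hg
  refine ⟨fun z => f (q * z), ?_, rfl⟩
  have h : AnalyticAt ℂ (fun z : ℂ => (q : ℂ) * z) 0 := by fun_prop
  exact MeromorphicAt.comp_analyticAt (by simpa using hf) h

/-- The `q`-difference operator `σ_q : f(z) ↦ f(qz)` on germs. -/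
noncomputable def sigmaQ (q : ℂˣ) : MeroGerm →ₐ[ℂ] MeroGerm where
  toFun g := ⟨(g : Germ (𝓝[≠] (0 : ℂ)) ℂ).compTendsto _ (tendsto_mul_punctured q),
    meroGerm_comp_mem q g.2⟩
  map_one' := rfl
  map_zero' := rfl
  map_mul' := by
    rintro ⟨_, f, hf, rfl⟩ ⟨_, g, hg, rfl⟩
    rfl
  map_add' := by
    rintro ⟨_, f, hf, rfl⟩ ⟨_, g, hg, rfl⟩
    rfl
  commutes' _ := rfl

/-- `f` is a continuation of the germ `g` to a holomorphic function on `ℂ^*`. -/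
def Continues (g : MeroGerm) (f : ℂ → ℂ) : Prop :=
  AnalyticOnNhd ℂ f {0}ᶜ ∧ (f : Germ (𝓝[≠] (0 : ℂ)) ℂ) = g

lemma Continues.unique {g : MeroGerm} {f f' : ℂ → ℂ} (h : Continues g f) (h' : Continues g f')
    {z : ℂ} (hz : z ≠ 0) : f z = f' z := by
  have hp : IsPreconnected ({0}ᶜ : Set ℂ) :=
    (isConnected_compl_singleton_of_one_lt_rank (by simp) (0 : ℂ)).isPreconnected
  have he : f =ᶠ[𝓝[≠] 0] f' := Germ.coe_eq.1 (h.2.trans h'.2.symm)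
  have he2 : ∀ᶠ w in 𝓝[≠] (0 : ℂ), f =ᶠ[𝓝 w] f' := by
    have := eventually_eventually_nhdsWithin.2 he
    filter_upwards [this, self_mem_nhdsWithin] with w hw hw0
    rwa [IsOpen.nhdsWithin_eq isOpen_compl_singleton hw0] at hw
  obtain ⟨w, hw, hw0⟩ := (he2.and self_mem_nhdsWithin).exists
  exact h.1.eqOn_of_preconnected_of_eventuallyEq h'.1 hp hw0 hw hz

open Classical in
/-- The value at `z` of (the holomorphic continuation to `ℂ^*` of) a germ; by convention `0`
if there is no continuation. -/
noncomputable def germEval (g : MeroGerm) (z : ℂ) : ℂ :=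
  if h : ∃ f, Continues g f then h.choose z else 0

lemma Continues.eval {g : MeroGerm} {f : ℂ → ℂ} (h : Continues g f) {z : ℂ} (hz : z ≠ 0) :
    germEval g z = f z := by
  have h' : ∃ f, Continues g f := ⟨f, h⟩
  rw [germEval, dif_pos h']
  exact h'.choose_spec.unique h hz

lemma Continues.const (c : ℂ) : Continues (algebraMap ℂ MeroGerm c) (fun _ => c) :=
  ⟨fun _ _ => analyticAt_const, rfl⟩

lemma Continues.mul {g g' : MeroGerm} {f f' : ℂ → ℂ} (h : Continues g f) (h' : Continues g' f') :
    Continues (g * g') (f * f') :=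
  ⟨h.1.mul h'.1, by rw [Germ.coe_mul, h.2, h'.2]; rfl⟩

lemma Continues.add {g g' : MeroGerm} {f f' : ℂ → ℂ} (h : Continues g f) (h' : Continues g' f') :
    Continues (g + g') (f + f') :=
  ⟨h.1.add h'.1, by rw [Germ.coe_add, h.2, h'.2]; rfl⟩

lemma Continues.sum {ι : Type} (s : Finset ι) {g : ι → MeroGerm} {f : ι → ℂ → ℂ}
    (h : ∀ i, Continues (g i) (f i)) : Continues (∑ i ∈ s, g i) (∑ i ∈ s, f i) := by
  classical
  induction s using Finset.induction_on with
  | empty => exact ⟨fun _ _ => analyticAt_const, rfl⟩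
  | insert a s ha ih => rw [Finset.sum_insert ha, Finset.sum_insert ha]; exact (h a).add ih

/-- The category of flat objects of the local category at `0`: objects `(ℂ^n, A)`, morphisms
`(ℂ^n, A) → (ℂ^p, B)` the `F ∈ M_{p,n}(ℂ({z}))` such that `F(qz) A = B F(z)`. -/
abbrev FlatLocal (q : ℂˣ) : Type := FlatSys MeroGerm (sigmaQ q)

/-- Every entry of a morphism in `FlatLocal q` has a continuation to `ℂ^*`. -/
lemma exists_continues {q : ℂˣ} (hq : 1 < ‖(q : ℂ)‖) {X Y : FlatLocal q} (F : X ⟶ Y) :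
    ∃ f : Fin Y.rank → Fin X.rank → ℂ → ℂ, ∀ i j, Continues (FlatSys.matrix F i j) (f i j) := by
  classical
  choose f hf hfg using fun i j => (FlatSys.matrix F i j).2
  set A : Matrix (Fin X.rank) (Fin X.rank) ℂ := X.A.val with hA
  set B : Matrix (Fin Y.rank) (Fin Y.rank) ℂ := Y.A.val with hB
  set A' : Matrix (Fin X.rank) (Fin X.rank) ℂ := X.A.inv with hA'
  let M : ℂ → Matrix (Fin Y.rank) (Fin X.rank) ℂ := fun z => Matrix.of fun i j => f i j z
  -- functional equation near 0
  have h1 : ∀ᶠ z in 𝓝[≠] (0 : ℂ), M (q * z) * A = B * M z := by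
    have : ∀ i j, ∀ᶠ z in 𝓝[≠] (0 : ℂ), (M (q * z) * A) i j = (B * M z) i j := by
      intro i j
      have hc := congrArg Subtype.val (congrFun (congrFun F.comm i) j)
      simp only [Matrix.mul_apply, AddSubmonoidClass.coe_finsetSum, Subring.coe_mul] at hc
      have hl : ((fun z => (M (q * z) * A) i j : ℂ → ℂ) : Germ (𝓝[≠] (0 : ℂ)) ℂ) =
          ∑ k, ((F.mat.map (sigmaQ q) i k : MeroGerm) : Germ (𝓝[≠] (0 : ℂ)) ℂ) *
            ((constMat MeroGerm X.A.val k j : MeroGerm) : Germ (𝓝[≠] (0 : ℂ)) ℂ) := by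
        have : (fun z => (M (q * z) * A) i j : ℂ → ℂ) =
            ∑ k, (fun z => f i k (q * z)) * (fun _ => A k j) := by
          funext z
          simp [M, Matrix.mul_apply, Finset.sum_apply]
        rw [this]
        change Germ.coeRingHom _ _ = _
        rw [map_sum]
        refine Finset.sum_congr rfl fun k _ => ?_
        rw [map_mul]
        have h0 : F.mat i k = ⟨(f i k : Germ (𝓝[≠] (0 : ℂ)) ℂ), f i k, hf i k, rfl⟩ :=
          Subtype.ext (hfg i k).symm
        rw [Matrix.map_apply, h0]
        rfl
      have hr : ((fun z => (B * M z) i j : ℂ → ℂ) : Germ (𝓝[≠] (0 : ℂ)) ℂ) =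
          ∑ k, ((constMat MeroGerm Y.A.val i k : MeroGerm) : Germ (𝓝[≠] (0 : ℂ)) ℂ) *
            ((F.mat k j : MeroGerm) : Germ (𝓝[≠] (0 : ℂ)) ℂ) := by
        have : (fun z => (B * M z) i j : ℂ → ℂ) = ∑ k, (fun _ => B i k) * f k j := by
          funext z
          simp [M, Matrix.mul_apply, Finset.sum_apply]
        rw [this]
        change Germ.coeRingHom _ _ = _
        rw [map_sum]
        refine Finset.sum_congr rfl fun k _ => ?_
        rw [map_mul, ← hfg k j]
        rfl
      exact Germ.coe_eq.1 (hl.trans (hc.trans hr.symm))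
    filter_upwards [eventually_all.2 fun i => eventually_all.2 fun j => this i j] with z hz
    ext i j
    exact hz i j
  have h2 : ∀ᶠ z in 𝓝[≠] (0 : ℂ), ∀ i j, AnalyticAt ℂ (f i j) z :=
    eventually_all.2 fun i => eventually_all.2 fun j => (hf i j).eventually_analyticAt
  obtain ⟨r, hr, hr'⟩ : ∃ r > 0, ∀ z : ℂ, z ≠ 0 → ‖z‖ < r →
      M (q * z) * A = B * M z ∧ ∀ i j, AnalyticAt ℂ (f i j) z := by
    have := (h1.and h2)
    rw [eventually_nhdsWithin_iff, Metric.eventually_nhds_iff] at this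
    obtain ⟨r, hr, h⟩ := this
    exact ⟨r, hr, fun z hz hzr => h (by simpa using hzr) hz⟩
  have hAA' : A * A' = 1 := X.A.val_inv
  -- the k-th extension
  let H : ℕ → ℂ → Matrix (Fin Y.rank) (Fin X.rank) ℂ :=
    fun k z => B ^ k * M ((q : ℂ)⁻¹ ^ k * z) * A' ^ k
  have hstep : ∀ k z, z ≠ 0 → ‖(q : ℂ)⁻¹ ^ k * z‖ < r → H (k + 1) z = H k z ∧
      ‖(q : ℂ)⁻¹ ^ (k + 1) * z‖ < r := by
    intro k z hz hk
    have hlt : ‖(q : ℂ)⁻¹ ^ (k + 1) * z‖ < r := by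
      refine lt_of_le_of_lt ?_ hk
      rw [pow_succ', mul_assoc, norm_mul]
      refine mul_le_of_le_one_left (norm_nonneg _) ?_
      rw [norm_inv]
      exact inv_le_one_of_one_le₀ hq.le
    refine ⟨?_, hlt⟩
    have hne : (q : ℂ)⁻¹ ^ (k + 1) * z ≠ 0 :=
      mul_ne_zero (pow_ne_zero _ (inv_ne_zero q.ne_zero)) hz
    have h3 := (hr' _ hne hlt).1
    have h4 : (q : ℂ) * ((q : ℂ)⁻¹ ^ (k + 1) * z) = (q : ℂ)⁻¹ ^ k * z := by
      rw [pow_succ', ← mul_assoc, ← mul_assoc, mul_inv_cancel₀ q.ne_zero, one_mul]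
    rw [h4] at h3
    change B ^ (k + 1) * M ((q : ℂ)⁻¹ ^ (k + 1) * z) * A' ^ (k + 1) = B ^ k * M _ * A' ^ k
    rw [pow_succ B, pow_succ' A']
    calc B ^ k * B * M ((q : ℂ)⁻¹ ^ (k + 1) * z) * (A' * A' ^ k)
        = B ^ k * (B * M ((q : ℂ)⁻¹ ^ (k + 1) * z)) * (A' * A' ^ k) := by
          simp only [Matrix.mul_assoc]
      _ = B ^ k * M ((q : ℂ)⁻¹ ^ k * z) * (A * A') * A' ^ k := by
          rw [← h3]; simp only [Matrix.mul_assoc]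
      _ = _ := by rw [hAA', Matrix.mul_one]
  have hmono : ∀ z, z ≠ 0 → ∀ k l, k ≤ l → ‖(q : ℂ)⁻¹ ^ k * z‖ < r → H l z = H k z := by
    intro z hz k l hkl hk
    have : H l z = H k z ∧ ‖(q : ℂ)⁻¹ ^ l * z‖ < r := by
      induction l, hkl using Nat.le_induction with
      | base => exact ⟨rfl, hk⟩
      | succ l _ ih => exact ⟨(hstep l z hz ih.2).1.trans ih.1, (hstep l z hz ih.2).2⟩
    exact this.1
  have hex : ∀ z : ℂ, ∃ k : ℕ, ‖(q : ℂ)⁻¹ ^ k * z‖ < r := by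
    intro z
    have h5 : ‖(q : ℂ)⁻¹‖ < 1 := by rw [norm_inv]; exact inv_lt_one_of_one_lt₀ hq
    have h6 : Tendsto (fun k : ℕ => (q : ℂ)⁻¹ ^ k * z) atTop (𝓝 (0 * z)) :=
      (tendsto_pow_atTop_nhds_zero_of_norm_lt_one h5).mul_const z
    rw [zero_mul] at h6
    have h7 := h6.norm
    rw [norm_zero] at h7
    exact (h7.eventually (gt_mem_nhds hr)).exists
  let k : ℂ → ℕ := fun z => Nat.find (hex z)
  have hk : ∀ z, ‖(q : ℂ)⁻¹ ^ k z * z‖ < r := fun z => Nat.find_spec (hex z)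
  let G : ℂ → Matrix (Fin Y.rank) (Fin X.rank) ℂ := fun z => H (k z) z
  have hG : ∀ z l, z ≠ 0 → ‖(q : ℂ)⁻¹ ^ l * z‖ < r → G z = H l z := fun z l hz hl =>
    (hmono z hz (k z) l (Nat.find_min' (hex z) hl) (hk z)).symm
  refine ⟨fun i j z => G z i j, fun i j => ⟨fun z hz => ?_, ?_⟩⟩
  · have hz' : z ≠ 0 := hz
    have hnear : ∀ᶠ w in 𝓝 z, G w i j = H (k z) w i j := by
      have hc : Continuous fun w : ℂ => ‖(q : ℂ)⁻¹ ^ k z * w‖ := by fun_prop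
      filter_upwards [hc.continuousAt.eventually (gt_mem_nhds (hk z)), isOpen_ne.mem_nhds hz']
        with w hw hw0
      rw [hG w (k z) hw0 hw]
    refine AnalyticAt.congr ?_ (hnear.mono fun _ h => h.symm)
    have hne : (q : ℂ)⁻¹ ^ k z * z ≠ 0 :=
      mul_ne_zero (pow_ne_zero _ (inv_ne_zero q.ne_zero)) hz'
    have han := (hr' _ hne (hk z)).2
    have hfun : (fun w => H (k z) w i j) = fun w => ∑ b, (∑ a, (B ^ k z) i a *
        f a b ((q : ℂ)⁻¹ ^ k z * w)) * (A' ^ k z) b j := by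
      funext w
      simp [H, M, Matrix.mul_apply]
    rw [hfun]
    refine Finset.analyticAt_fun_sum _ fun b _ => AnalyticAt.mul ?_ analyticAt_const
    refine Finset.analyticAt_fun_sum _ fun a _ => AnalyticAt.mul analyticAt_const ?_
    exact AnalyticAt.fun_comp (han a b) (by fun_prop)
  · rw [← hfg i j]
    refine Germ.coe_eq.2 ?_
    rw [EventuallyEq, eventually_nhdsWithin_iff, Metric.eventually_nhds_iff]
    refine ⟨r, hr, fun z hz hz0 => ?_⟩
    have := hG z 0 hz0 (by simpa using hz)
    simp [this, H, M]

lemma germEval_const (c z : ℂ) (hz : z ≠ 0) : germEval (algebraMap ℂ MeroGerm c) z = c :=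
  (Continues.const c).eval hz

lemma germEval_mul {n m p : ℕ} {F : Matrix (Fin n) (Fin m) MeroGerm}
    {G : Matrix (Fin m) (Fin p) MeroGerm} {f : Fin n → Fin m → ℂ → ℂ} {g : Fin m → Fin p → ℂ → ℂ}
    (hF : ∀ i j, Continues (F i j) (f i j)) (hG : ∀ i j, Continues (G i j) (g i j))
    {z : ℂ} (hz : z ≠ 0) :
    (F * G).map (germEval · z) = F.map (germEval · z) * G.map (germEval · z) := by
  ext i j
  have h : Continues ((F * G) i j) (∑ k, f i k * g k j) := by
    rw [Matrix.mul_apply]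
    exact Continues.sum _ fun k => (hF i k).mul (hG k j)
  simp only [Matrix.map_apply, Matrix.mul_apply]
  rw [← Matrix.mul_apply, h.eval hz, Finset.sum_apply]
  refine Finset.sum_congr rfl fun k _ => ?_
  rw [(hF i k).eval hz, (hG k j).eval hz, Pi.mul_apply]

lemma germEval_kron {n m n' m' : ℕ} {F : Matrix (Fin n) (Fin m) MeroGerm}
    {G : Matrix (Fin n') (Fin m') MeroGerm} {f : Fin n → Fin m → ℂ → ℂ}
    {g : Fin n' → Fin m' → ℂ → ℂ}
    (hF : ∀ i j, Continues (F i j) (f i j)) (hG : ∀ i j, Continues (G i j) (g i j))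
    {z : ℂ} (hz : z ≠ 0) :
    (kron F G).map (germEval · z) = kron (F.map (germEval · z)) (G.map (germEval · z)) := by
  ext i j
  simp only [kron, Matrix.map_apply, Matrix.submatrix_apply, Matrix.kroneckerMap_apply]
  rw [((hF _ _).mul (hG _ _)).eval hz, (hF _ _).eval hz, (hG _ _).eval hz, Pi.mul_apply]

lemma germEval_constMat {n m : ℕ} (A : Matrix (Fin n) (Fin m) ℂ) {z : ℂ} (hz : z ≠ 0) :
    (constMat MeroGerm A).map (germEval · z) = A := by
  ext i j
  exact germEval_const _ _ hz

lemma germEval_one (n : ℕ) {z : ℂ} (hz : z ≠ 0) :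
    (1 : Matrix (Fin n) (Fin n) MeroGerm).map (germEval · z) = 1 := by
  rw [← constMat_one, germEval_constMat _ hz]

lemma germEval_permMat {n m : ℕ} (e : Fin n ≃ Fin m) {z : ℂ} (hz : z ≠ 0) :
    (permMat MeroGerm e).map (germEval · z) = permMat ℂ e := by
  have h : constMat MeroGerm (permMat ℂ e) = permMat MeroGerm e :=
    permMat_map e (algebraMap ℂ MeroGerm)
  rw [← h, germEval_constMat _ hz]

/-- The local fibre functor at `z₀`: `(ℂ^n, A) ↦ ℂ^n`, `F ↦ F(z₀)`. -/
noncomputable def fibre (q : ℂˣ) (hq : 1 < ‖(q : ℂ)‖) (z₀ : ℂˣ) : FlatLocal q ⥤ MatCat ℂ where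
  obj X := ⟨X.rank⟩
  map F := (FlatSys.matrix F).map (germEval · z₀)
  map_id X := germEval_one X.rank z₀.ne_zero
  map_comp F G := by
    obtain ⟨f, hf⟩ := exists_continues hq F
    obtain ⟨g, hg⟩ := exists_continues hq G
    exact germEval_mul hg hf z₀.ne_zero

lemma fibre_kron {q : ℂˣ} (hq : 1 < ‖(q : ℂ)‖) (z₀ : ℂˣ) {X Y X' Y' : FlatLocal q}
    (F : X ⟶ Y) (G : X' ⟶ Y') :
    (fibre q hq z₀).map (F ⊗ₘ G) = (fibre q hq z₀).map F ⊗ₘ (fibre q hq z₀).map G := by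
  obtain ⟨f, hf⟩ := exists_continues hq F
  obtain ⟨g, hg⟩ := exists_continues hq G
  exact germEval_kron hf hg z₀.ne_zero

/-- The fibre functors are tensor functors, with identities as structural isomorphisms. -/
noncomputable instance (q : ℂˣ) (hq : 1 < ‖(q : ℂ)‖) (z₀ : ℂˣ) : (fibre q hq z₀).Monoidal :=
  Functor.CoreMonoidal.toMonoidal
  { εIso := Iso.refl _
    μIso := fun _ _ => Iso.refl _
    μIso_hom_natural_left := fun F X => by
      refine (Category.comp_id _).trans (Eq.trans ?_ (Category.id_comp _).symm)
      rw [← tensorHom_id, ← tensorHom_id, fibre_kron, CategoryTheory.Functor.map_id]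
    μIso_hom_natural_right := fun X F => by
      refine (Category.comp_id _).trans (Eq.trans ?_ (Category.id_comp _).symm)
      rw [← id_tensorHom, ← id_tensorHom, fibre_kron, CategoryTheory.Functor.map_id]
    associativity := fun X Y Z => by
      have h : (fibre q hq z₀).map (α_ X Y Z).hom =
          permMat ℂ (assocEquiv X.rank Y.rank Z.rank) := germEval_permMat _ z₀.ne_zero
      rw [h]
      exact strict_assoc_aux X.rank Y.rank Z.rank
    left_unitality := fun X => by
      have h : (fibre q hq z₀).map (λ_ X).hom = permMat ℂ (leftEquiv X.rank) :=
        germEval_permMat _ z₀.ne_zero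
      rw [h]
      exact strict_left_aux X.rank
    right_unitality := fun X => by
      have h : (fibre q hq z₀).map (ρ_ X).hom = permMat ℂ (rightEquiv X.rank) :=
        germEval_permMat _ z₀.ne_zero
      rw [h]
      exact strict_right_aux X.rank }

end Germs

section Representations

/-- The tensor category of the finite dimensional complex representations of `ℤ`, in the form of
pairs `(ℂ^n, A)`, `A ∈ GL_n(ℂ)` being the image of `1 ∈ ℤ`; a morphism `(ℂ^n, A) → (ℂ^p, B)` is
an `F ∈ M_{p,n}(ℂ)` with `F A = B F`. -/
abbrev RepZ : Type := FlatSys ℂ (AlgHom.id ℂ ℂ)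

/-- The forgetful functor `(ℂ^n, A) ↦ ℂ^n`, `F ↦ F` on representations of `ℤ`. -/
abbrev forgetZ : RepZ ⥤ MatCat ℂ := toMat ℂ (AlgHom.id ℂ ℂ)

/-- The embedding of the representations of `ℤ` in the flat systems: the identity on
objects, and morphisms are seen as constant matrices. -/
noncomputable def embed (q : ℂˣ) : RepZ ⥤ FlatLocal q where
  obj X := ⟨X.rank, X.A⟩
  map {X Y} F := FlatSys.Hom.mk (constMat MeroGerm (FlatSys.matrix F)) (by
    have h : FlatSys.matrix F * X.A.val = Y.A.val * FlatSys.matrix F := F.comm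
    rw [constMat_map, ← constMat_mul, ← constMat_mul, h])
  map_id X := flatSys_ext (constMat_one X.rank)
  map_comp F G := flatSys_ext (constMat_mul _ _)

/-- `Aut^⊗(ω)`: the group of the automorphisms of the forgetful functor `ω` that are natural and
compatible with tensor products. -/
abbrev TensorAut : Type := Aut (LaxMonoidalFunctor.of forgetZ)

/-- `Iso^⊗(ω_{z₀}, ω_{z₁})`: the natural isomorphisms of the fibre functors at `z₀` and at `z₁`
that are compatible with tensor products. -/
abbrev TensorIso (q : ℂˣ) (hq : 1 < ‖(q : ℂ)‖) (z₀ z₁ : ℂˣ) : Type :=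
  LaxMonoidalFunctor.of (fibre q hq z₀) ≅ LaxMonoidalFunctor.of (fibre q hq z₁)

/-- The restriction of a tensor isomorphism `ω_{z₀} → ω_{z₁}` to the representations of `ℤ`, on
which both fibre functors are the forgetful functor. -/
noncomputable def restrict (q : ℂˣ) (hq : 1 < ‖(q : ℂ)‖) (z₀ z₁ : ℂˣ)
    (η : TensorIso q hq z₀ z₁) : TensorAut :=
  LaxMonoidalFunctor.isoOfComponents
    (fun X =>
      { hom := η.hom.hom.app ((embed q).obj X)
        inv := η.inv.hom.app ((embed q).obj X)
        hom_inv_id := congrArg (fun α => α.hom.app ((embed q).obj X)) η.hom_inv_id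
        inv_hom_id := congrArg (fun α => α.hom.app ((embed q).obj X)) η.inv_hom_id })
    (fun {X Y} F => by
      have h := η.hom.hom.naturality ((embed q).map F)
      have h0 : (fibre q hq z₀).map ((embed q).map F) = FlatSys.matrix F :=
        germEval_constMat _ z₀.ne_zero
      have h1 : (fibre q hq z₁).map ((embed q).map F) = FlatSys.matrix F :=
        germEval_constMat _ z₁.ne_zero
      change (fibre q hq z₀).map ((embed q).map F) ≫ _ =
        _ ≫ (fibre q hq z₁).map ((embed q).map F) at h
      rw [h0, h1] at h
      exact h)
    η.hom.isMonoidal.unit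
    (fun X Y => η.hom.isMonoidal.tensor ((embed q).obj X) ((embed q).obj Y))

end Representations

section ProalgebraicHull

/-- `ℤ^alg = Hom_grp(ℂ^*, ℂ^*) × ℂ`, with the pointwise product of homomorphisms and the
addition of `ℂ`. -/
abbrev ZAlg : Type := (ℂˣ →* ℂˣ) × Multiplicative ℂ

/-- The matrix `Q diag(c₁, …, c_n) Q⁻¹`. -/
noncomputable def conjDiag {n : ℕ} (Q : GL (Fin n) ℂ) (c : Fin n → ℂˣ) :
    Matrix (Fin n) (Fin n) ℂ :=
  Q.val * Matrix.diagonal (fun i => (c i : ℂ)) * (Q⁻¹).val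

/-- The power `U^t = ∑_k binom(t, k) (U - 1)^k` of a unipotent `n × n` matrix `U`; the terms with
`k ≥ n` vanish. -/
noncomputable def unipPow {n : ℕ} (U : Matrix (Fin n) (Fin n) ℂ) (t : ℂ) :
    Matrix (Fin n) (Fin n) ℂ :=
  ∑ k ∈ Finset.range n, Ring.choose t k • (U - 1) ^ k

/-- A (multiplicative) Dunford decomposition `A = S U` of `A ∈ GL_n(ℂ)`, with a diagonalization
`S = Q diag(c₁, …, c_n) Q⁻¹` of the semi-simple factor, and `U` unipotent and commuting with `S`. -/
structure Dunford {n : ℕ} (A : GL (Fin n) ℂ) where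
  /-- a basis of eigenvectors of the semi-simple factor -/
  Q : GL (Fin n) ℂ
  /-- the eigenvalues -/
  c : Fin n → ℂˣ
  /-- the unipotent factor -/
  U : Matrix (Fin n) (Fin n) ℂ
  unipotent : IsNilpotent (U - 1)
  commute : Commute (conjDiag Q c) U
  eq : A.val = conjDiag Q c * U

/-- The matrix `A^(γ, t) = γ(S) U^t`, where `γ(S) = Q diag(γ(c₁), …, γ(c_n)) Q⁻¹`. -/
noncomputable def Dunford.act {n : ℕ} {A : GL (Fin n) ℂ} (D : Dunford A) (g : ZAlg) :
    Matrix (Fin n) (Fin n) ℂ :=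
  conjDiag D.Q (fun i => g.1 (D.c i)) * unipPow D.U g.2.toAdd

/-- A semi-simple complex endomorphism is diagonalizable. -/
lemma exists_diag {n : ℕ} (S : Module.End ℂ (Fin n → ℂ)) (hS : S.IsSemisimple) :
    ∃ (Q : GL (Fin n) ℂ) (μ : Fin n → ℂ),
      LinearMap.toMatrix' S = Q.val * Matrix.diagonal μ * (Q⁻¹).val := by
  classical
  have hint : DirectSum.IsInternal fun μ => S.eigenspace μ :=
    DirectSum.isInternal_submodule_of_iSupIndep_of_iSup_eq_top
      S.eigenspaces_iSupIndep hS.iSup_eigenspace_eq_top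
  let b₀ := hint.collectedBasis fun μ => Module.finBasis ℂ (S.eigenspace μ)
  let b := b₀.reindex (b₀.indexEquiv (Pi.basisFun ℂ (Fin n)))
  let μ : Fin n → ℂ := fun i => ((b₀.indexEquiv (Pi.basisFun ℂ (Fin n))).symm i).1
  have hb : ∀ i, S (b i) = μ i • b i := by
    intro i
    have : b i ∈ S.eigenspace (μ i) := by
      rw [Module.Basis.reindex_apply]
      exact hint.collectedBasis_mem _ _
    exact Module.End.mem_eigenspace_iff.1 this
  let M := (Pi.basisFun ℂ (Fin n)).toMatrix b
  let Q : GL (Fin n) ℂ := ⟨M, b.toMatrix (Pi.basisFun ℂ (Fin n)),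
    Module.Basis.toMatrix_mul_toMatrix_flip _ _, Module.Basis.toMatrix_mul_toMatrix_flip _ _⟩
  refine ⟨Q, μ, ?_⟩
  have h : LinearMap.toMatrix' S * Q.val = Q.val * Matrix.diagonal μ := by
    ext i j
    rw [Matrix.mul_diagonal]
    have h1 := congrFun (hb j) i
    have h2 : Matrix.mulVec (LinearMap.toMatrix' S) (b j) = S (b j) := by
      rw [← Matrix.toLin'_apply, Matrix.toLin'_toMatrix']
    rw [← h2] at h1
    simpa [Matrix.mul_apply, Matrix.mulVec, dotProduct, Q, M, Module.Basis.toMatrix_apply,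
      mul_comm] using h1
  rw [← h, Matrix.mul_assoc, ← Units.val_mul, mul_inv_cancel, Units.val_one, Matrix.mul_one]

/-- Every invertible matrix has a Dunford decomposition. -/
lemma nonempty_dunford {n : ℕ} (A : GL (Fin n) ℂ) : Nonempty (Dunford A) := by
  classical
  obtain ⟨N, hN, S, hS, hNn, hSs, hNS⟩ :=
    Module.End.exists_isNilpotent_isSemisimple (K := ℂ) (f := Matrix.toLin' A.val)
  obtain ⟨Q, μ, hQ⟩ := exists_diag S hSs
  have hcomm : Commute N S := 
    Algebra.commute_of_mem_adjoin_singleton_of_commute hS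
      (Algebra.commute_of_mem_adjoin_self hN).symm
  let T := LinearMap.toMatrix' S
  let N' := LinearMap.toMatrix' N
  have hA : A.val = N' + T := by
    rw [← map_add, ← hNS, LinearMap.toMatrix'_toLin']
  have hc : Commute N' T := hcomm.map (LinearMap.toMatrixAlgEquiv' (R := ℂ) (n := Fin n))
  have hn : IsNilpotent N' := hNn.map (LinearMap.toMatrixAlgEquiv' (R := ℂ) (n := Fin n))
  have hu : IsUnit T := by
    have h1 : T = -N' + A.val := by rw [hA]; abel
    have h2 : Commute (-N') A.val := by
      rw [hA]; exact ((Commute.refl N').add_right hc).neg_left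
    rw [h1]
    exact (hn.neg).isUnit_add_right_of_commute A.isUnit h2
  obtain ⟨t, ht⟩ := hu
  have hμ : ∀ i, μ i ≠ 0 := by
    have h1 : IsUnit (Matrix.diagonal μ) := by
      have : Matrix.diagonal μ = (Q⁻¹ * t * Q).val := by
        rw [Units.val_mul, Units.val_mul, ht]
        change _ = _ * LinearMap.toMatrix' S * _
        rw [hQ]
        simp only [← Matrix.mul_assoc]
        rw [← Units.val_mul, inv_mul_cancel, Units.val_one, Matrix.one_mul, Matrix.mul_assoc,
          ← Units.val_mul, inv_mul_cancel, Units.val_one, Matrix.mul_one]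
      rw [this]
      exact Units.isUnit _
    rw [Matrix.isUnit_diagonal, Pi.isUnit_iff] at h1
    exact fun i => (h1 i).ne_zero
  have hTQ : conjDiag Q (fun i => Units.mk0 (μ i) (hμ i)) = T := hQ.symm
  have hct : Commute N' (t⁻¹).val := (ht ▸ hc : Commute N' t.val).units_inv_right
  refine ⟨⟨Q, fun i => Units.mk0 (μ i) (hμ i), (t⁻¹).val * A.val, ?_, ?_, ?_⟩⟩
  · have : (t⁻¹).val * A.val - 1 = N' * (t⁻¹).val := by
      rw [hA, mul_add, ← ht, ← Units.val_mul, inv_mul_cancel, Units.val_one, add_sub_cancel_right,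
        hct.eq]
    rw [this]
    exact hct.isNilpotent_mul_right hn
  · rw [hTQ, hA, mul_add, ← ht, ← Units.val_mul, inv_mul_cancel, Units.val_one]
    refine Commute.add_right (Commute.mul_right ?_ (ht ▸ hc.symm)) (Commute.one_right _)
    exact (Commute.refl t.val).units_inv_right
  · rw [hTQ, ← ht, ← mul_assoc, ← Units.val_mul, mul_inv_cancel, Units.val_one, one_mul]

end ProalgebraicHull
end LocalGalois

/-! The Dunford decomposition is functorial: a constant matrix `F` with `F A = B F` also satisfies
`F A_s = B_s F` and `F A_u = B_u F` (`Dunford.intertwine_semisimple`,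
`Dunford.intertwine_unipotent`). In eigenbases `F` has nonzero entries only between equal
eigenvalues, so it intertwines `γ(A_s)` and `γ(B_s)`; expanding in powers of `A_u - 1` and `B_u -
1`, it intertwines `A_u^t` and `B_u^t`. Hence the action of `(γ, t)` is natural, and `F = 1` gives
independence of the choices. It respects tensor products because `γ` is multiplicative and because
`(U ⊗ V)^t = U^t ⊗ V^t`, an identity between polynomials in `t` that is clear for natural `t`.

Conversely, a tensor automorphism is determined by its components on the rank one objects and on the
unipotent Jordan block of size 2 (`TensorAut.ext_of_generators`): the block of size `d + 1` is a
quotient of (size `d`) ⊗ (size 2), and every eigenvector of `A_s` lies in the image of a morphism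
from a Jordan block. The rank one components form a character `γ`. The inclusion of the unit in the
block of size 2 and the projection onto it force the component there to be unitriangular, with a
single free entry `t`. So the action is bijective onto the tensor automorphisms.

The flat local category has the same objects as the representations of `ℤ` and only more morphisms,
so restriction is injective and the question is which `(γ, t)` are natural for these morphisms. The
germ `z` is a morphism `(ℂ, 1) → (ℂ, q)`, which forces `γ(q) z₀ = z₁`. This suffices
(`fibre_intertwine`): the Laurent expansion of `F` at `0` converges on `ℂ^*` and has finite polar
part, and its coefficients satisfy `F_m (q^m A) = B F_m`. They are constant intertwiners, whence
`γ(q)^m F_m A^(γ,t) = B^(γ,t) F_m`; summing against `z₀^m` gives `F(γ(q) z₀) A^(γ,t) = B^(γ,t)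
F(z₀)`. No continuity of `γ` enters. -/

namespace LocalGalois

/-! ### Complex powers of unipotent matrices, by interpolation from natural exponents. -/

section UnipotentPowers

/-- A function `ℂ → ℂ` given by a polynomial. -/
def IsPolyFun (f : ℂ → ℂ) : Prop := ∃ p : Polynomial ℂ, ∀ t, f t = p.eval t

lemma IsPolyFun.const (c : ℂ) : IsPolyFun fun _ => c := ⟨Polynomial.C c, fun _ => by simp⟩

lemma IsPolyFun.mul {f g : ℂ → ℂ} (hf : IsPolyFun f) (hg : IsPolyFun g) :
    IsPolyFun fun t => f t * g t := by
  obtain ⟨p, hp⟩ := hf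
  obtain ⟨r, hr⟩ := hg
  exact ⟨p * r, fun t => by simp [hp, hr]⟩

lemma IsPolyFun.sum {ι : Type*} (s : Finset ι) {f : ι → ℂ → ℂ} (hf : ∀ i, IsPolyFun (f i)) :
    IsPolyFun fun t => ∑ i ∈ s, f i t := by
  choose p hp using hf
  exact ⟨∑ i ∈ s, p i, fun t => by simp [hp, Polynomial.eval_finsetSum]⟩

lemma IsPolyFun.comp_add {f : ℂ → ℂ} (hf : IsPolyFun f) (s : ℂ) :
    IsPolyFun fun t => f (s + t) := by
  obtain ⟨p, hp⟩ := hf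
  exact ⟨p.comp (Polynomial.C s + Polynomial.X), fun t => by simp [hp]⟩

lemma isPolyFun_choose (k : ℕ) : IsPolyFun fun t => Ring.choose t k := by
  refine ⟨Polynomial.C ((k.factorial : ℂ)⁻¹) * (descPochhammer ℤ k).map (Int.castRingHom ℂ),
    fun t => ?_⟩
  change Ring.choose t k = _
  rw [Ring.choose_eq_smul, Polynomial.eval_mul, Polynomial.eval_C, smul_eq_mul,
    ← Polynomial.aeval_eq_smeval, Polynomial.eval_map]
  rfl

/-- Two polynomials that agree on an infinite set coincide. This carries the identities for
`unipPow` from natural to complex exponents. -/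
lemma IsPolyFun.eq_of_nat {f g : ℂ → ℂ} (hf : IsPolyFun f) (hg : IsPolyFun g)
    (h : ∀ k : ℕ, f k = g k) : f = g := by
  obtain ⟨p, hp⟩ := hf
  obtain ⟨r, hr⟩ := hg
  have : p = r := by
    refine Polynomial.eq_of_infinite_eval_eq p r
      ((Set.infinite_range_of_injective (Nat.cast_injective (R := ℂ))).mono ?_)
    rintro _ ⟨k, rfl⟩
    rw [Set.mem_ofPred_eq, ← hp, ← hr, h]
  funext t
  rw [hp, hr, this]

/-- Cayley–Hamilton: the characteristic polynomial of a nilpotent endomorphism is `X ^ n`. -/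
lemma pow_eq_zero_of_isNilpotent {n : ℕ} {N : Matrix (Fin n) (Fin n) ℂ} (hN : IsNilpotent N)
    {k : ℕ} (hk : n ≤ k) : N ^ k = 0 := by
  have h1 : IsNilpotent (Matrix.toLinAlgEquiv' N) := hN.map _
  have h2 := LinearMap.aeval_self_charpoly (Matrix.toLinAlgEquiv' N)
  rw [h1.charpoly_eq_X_pow_finrank] at h2
  simp only [Module.finrank_fintype_fun_eq_card, Fintype.card_fin, map_pow,
    Polynomial.aeval_X] at h2
  rw [← map_pow] at h2
  have h3 : N ^ n = 0 := (map_eq_zero_iff _ (Matrix.toLinAlgEquiv' (R := ℂ)).injective).1 h2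
  exact pow_eq_zero_of_le hk h3

/-- A common truncation order makes the series of matrices of different sizes comparable term by
term. -/
lemma unipPow_eq_sum {n : ℕ} {U : Matrix (Fin n) (Fin n) ℂ} (hU : IsNilpotent (U - 1)) (t : ℂ)
    {m : ℕ} (hm : n ≤ m) : unipPow U t = ∑ k ∈ Finset.range m, Ring.choose t k • (U - 1) ^ k := by
  refine Finset.sum_subset (Finset.range_mono hm) fun k _ hk => ?_
  rw [pow_eq_zero_of_isNilpotent hU (by simpa using hk), smul_zero]

lemma unipPow_natCast {n : ℕ} {U : Matrix (Fin n) (Fin n) ℂ} (hU : IsNilpotent (U - 1)) (k : ℕ) :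
    unipPow U k = U ^ k := by
  have h1 : U ^ k = ((U - 1) + 1) ^ k := by rw [sub_add_cancel]
  -- The range `k + 1 + n` contains both ranges of summation: the binomial coefficients vanish
  -- beyond `k`, the powers of `U - 1` from `n` on.
  rw [h1, (Commute.one_right (U - 1)).add_pow, unipPow_eq_sum hU _ (Nat.le_add_left n (k + 1))]
  symm
  refine Finset.sum_subset_zero_on_sdiff (Finset.range_mono (Nat.le_add_right _ _)) ?_ ?_
  · intro j hj
    have hj' : k < j := by
      simp only [Finset.mem_sdiff, Finset.mem_range] at hj
      omega
    rw [Ring.choose_natCast, Nat.choose_eq_zero_of_lt hj', Nat.cast_zero, zero_smul]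
  · intro j _
    rw [Ring.choose_natCast, one_pow, mul_one, ← nsmul_eq_mul', Nat.cast_smul_eq_nsmul]

lemma unipPow_zero_right {n : ℕ} {U : Matrix (Fin n) (Fin n) ℂ} (hU : IsNilpotent (U - 1)) :
    unipPow U 0 = 1 := by
  simpa using unipPow_natCast hU 0

lemma isPolyFun_unipPow {n : ℕ} (U : Matrix (Fin n) (Fin n) ℂ) (i j : Fin n) :
    IsPolyFun fun t => unipPow U t i j := by
  simp only [unipPow, Matrix.sum_apply, Matrix.smul_apply, smul_eq_mul]
  exact IsPolyFun.sum _ fun k => (isPolyFun_choose k).mul (IsPolyFun.const _)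

/-- Both sides are polynomial in each exponent separately, so interpolation in one variable after
the other reduces to `U ^ (k + l) = U ^ k * U ^ l`. -/
lemma unipPow_add {n : ℕ} {U : Matrix (Fin n) (Fin n) ℂ} (hU : IsNilpotent (U - 1)) (s t : ℂ) :
    unipPow U (s + t) = unipPow U s * unipPow U t := by
  have key : ∀ s : ℂ, (∀ k : ℕ, unipPow U (s + k) = unipPow U s * unipPow U k) →
      ∀ t, unipPow U (s + t) = unipPow U s * unipPow U t := by
    intro s hs t
    ext i j
    have h := IsPolyFun.eq_of_nat ((isPolyFun_unipPow U i j).comp_add s)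
      (g := fun t => (unipPow U s * unipPow U t) i j) ?_ (fun k => by rw [hs k])
    · exact congrFun h t
    · simp only [Matrix.mul_apply]
      exact IsPolyFun.sum _ fun a => (IsPolyFun.const _).mul (isPolyFun_unipPow U a j)
  -- Here `t` has become a natural number `k`. As `U ^ k` commutes with `unipPow U s`, the roles can
  -- be exchanged and `s` interpolated in turn.
  refine key s (fun k => ?_) t
  have hc : Commute (unipPow U k) (unipPow U s) := by
    rw [unipPow_natCast hU]
    refine Commute.sum_right _ _ _ fun j _ => Commute.smul_right (Commute.pow_right ?_ _) _
    exact ((Commute.refl U).sub_right (Commute.one_right U)).pow_left k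
  rw [add_comm s, ← hc.eq]
  refine key k (fun l => ?_) s
  rw [← Nat.cast_add, unipPow_natCast hU, unipPow_natCast hU, unipPow_natCast hU, pow_add]

lemma kron_pow {n m : ℕ} (A : Matrix (Fin n) (Fin n) ℂ) (B : Matrix (Fin m) (Fin m) ℂ) (k : ℕ) :
    kron A B ^ k = kron (A ^ k) (B ^ k) := by
  induction k with
  | zero => simp [kron_one]
  | succ k ih => rw [pow_succ, ih, kron_mul, pow_succ, pow_succ]

/-- `U ⊗ V - 1 = (U - 1) ⊗ V + 1 ⊗ (V - 1)` is a sum of two commuting nilpotent matrices. -/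
lemma kron_sub_one_isNilpotent {n m : ℕ} {U : Matrix (Fin n) (Fin n) ℂ}
    {V : Matrix (Fin m) (Fin m) ℂ} (hU : IsNilpotent (U - 1)) (hV : IsNilpotent (V - 1)) :
    IsNilpotent (kron U V - 1) := by
  have e : kron U V - 1 = kron (U - 1) V + kron 1 (V - 1) := by
    rw [← kron_one]
    ext i j
    simp only [kron, Matrix.submatrix_apply, Matrix.sub_apply, Matrix.add_apply,
      Matrix.kroneckerMap_apply]
    ring
  rw [e]
  refine Commute.isNilpotent_add ?_ ?_ ?_
  · change _ * _ = _ * _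
    rw [kron_mul, kron_mul, mul_one, one_mul, mul_sub, sub_mul, mul_one, one_mul]
  · obtain ⟨k, hk⟩ := hU
    exact ⟨k, by rw [kron_pow, hk]; ext; simp [kron]⟩
  · obtain ⟨k, hk⟩ := hV
    exact ⟨k, by rw [kron_pow, hk]; ext; simp [kron]⟩

lemma unipPow_kron {n m : ℕ} {U : Matrix (Fin n) (Fin n) ℂ}
    {V : Matrix (Fin m) (Fin m) ℂ} (hU : IsNilpotent (U - 1)) (hV : IsNilpotent (V - 1)) (t : ℂ) :
    unipPow (kron U V) t = kron (unipPow U t) (unipPow V t) := by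
  ext i j
  have h := IsPolyFun.eq_of_nat (isPolyFun_unipPow (kron U V) i j)
    (g := fun t => kron (unipPow U t) (unipPow V t) i j) ?_ (fun k => ?_)
  · exact congrFun h t
  · exact (isPolyFun_unipPow U _ _).mul (isPolyFun_unipPow V _ _)
  · rw [unipPow_natCast hU, unipPow_natCast hV, unipPow_natCast (kron_sub_one_isNilpotent hU hV),
      kron_pow]

lemma unipPow_intertwine {n p : ℕ} {U : Matrix (Fin n) (Fin n) ℂ} {V : Matrix (Fin p) (Fin p) ℂ}
    (hU : IsNilpotent (U - 1)) (hV : IsNilpotent (V - 1)) {F : Matrix (Fin p) (Fin n) ℂ}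
    (h : F * U = V * F) (t : ℂ) : F * unipPow U t = unipPow V t * F := by
  have hk : ∀ k : ℕ, F * (U - 1) ^ k = (V - 1) ^ k * F := by
    intro k
    induction k with
    | zero => simp
    | succ k ih =>
      rw [pow_succ, ← Matrix.mul_assoc, ih, Matrix.mul_assoc, Matrix.mul_sub, h, Matrix.mul_one,
        pow_succ, Matrix.mul_assoc, Matrix.sub_mul, Matrix.one_mul]
  rw [unipPow_eq_sum hU t (le_max_left n p), unipPow_eq_sum hV t (le_max_right n p),
    Matrix.mul_sum, Matrix.sum_mul]
  exact Finset.sum_congr rfl fun k _ => by rw [Matrix.mul_smul, hk, Matrix.smul_mul]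

end UnipotentPowers

/-! ### Functoriality of the Dunford decomposition and of the action of `(γ, t)`. -/

section SemisimpleFactor

lemma conjDiag_mul {n : ℕ} (Q : GL (Fin n) ℂ) (c d : Fin n → ℂˣ) :
    conjDiag Q (c * d) = conjDiag Q c * conjDiag Q d := by
  have h : (Q⁻¹).val * Q.val = 1 := by rw [← Units.val_mul, inv_mul_cancel, Units.val_one]
  have : Matrix.diagonal (fun i => (((c * d) i : ℂˣ) : ℂ)) =
      Matrix.diagonal (fun i => (c i : ℂ)) * Matrix.diagonal (fun i => (d i : ℂ)) := by
    simp
  simp only [conjDiag, this, Matrix.mul_assoc]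
  rw [← Matrix.mul_assoc (Q⁻¹).val Q.val, h, Matrix.one_mul]

lemma conjDiag_one {n : ℕ} (Q : GL (Fin n) ℂ) : conjDiag Q 1 = 1 := by
  simp only [conjDiag, Pi.one_apply, Units.val_one, Matrix.diagonal_one, Matrix.mul_one]
  rw [← Units.val_mul, mul_inv_cancel, Units.val_one]

lemma conjDiag_smul {n : ℕ} (Q : GL (Fin n) ℂ) (u : ℂˣ) (c : Fin n → ℂˣ) :
    conjDiag Q (fun i => u * c i) = (u : ℂ) • conjDiag Q c := by
  have : Matrix.diagonal (fun i => ((u * c i : ℂˣ) : ℂ)) =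
      (u : ℂ) • Matrix.diagonal (fun i => (c i : ℂ)) := by
    rw [← Matrix.diagonal_smul]
    rfl
  simp only [conjDiag, this, Matrix.mul_smul, Matrix.smul_mul]

/-- In the bases of eigenvectors, intertwining two diagonalizable matrices is a condition on the
single entries. -/
lemma conjDiag_intertwine_iff {n p : ℕ} (Q : GL (Fin n) ℂ) (c : Fin n → ℂˣ) (Q' : GL (Fin p) ℂ)
    (c' : Fin p → ℂˣ) (F : Matrix (Fin p) (Fin n) ℂ) :
    F * conjDiag Q c = conjDiag Q' c' * F ↔
      ∀ i j, ((Q'⁻¹).val * F * Q.val) i j * c j = c' i * ((Q'⁻¹).val * F * Q.val) i j := by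
  have hQ : (Q⁻¹).val * Q.val = 1 := by rw [← Units.val_mul, inv_mul_cancel, Units.val_one]
  have hQ' : (Q'⁻¹).val * Q'.val = 1 := by rw [← Units.val_mul, inv_mul_cancel, Units.val_one]
  have hQ2 : Q.val * (Q⁻¹).val = 1 := by rw [← Units.val_mul, mul_inv_cancel, Units.val_one]
  have hQ2' : Q'.val * (Q'⁻¹).val = 1 := by rw [← Units.val_mul, mul_inv_cancel, Units.val_one]
  have hiff : (∀ i j, ((Q'⁻¹).val * F * Q.val) i j * c j =
      c' i * ((Q'⁻¹).val * F * Q.val) i j) ↔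
      (Q'⁻¹).val * F * Q.val * Matrix.diagonal (fun i => (c i : ℂ)) =
        Matrix.diagonal (fun i => (c' i : ℂ)) * ((Q'⁻¹).val * F * Q.val) := by
    rw [← Matrix.ext_iff]
    simp only [Matrix.mul_diagonal, Matrix.diagonal_mul]
  rw [hiff]
  constructor
  · intro h
    have := congrArg (fun M => (Q'⁻¹).val * M * Q.val) h
    simp only [conjDiag, Matrix.mul_assoc, hQ, Matrix.mul_one] at this ⊢
    rw [this, ← Matrix.mul_assoc (Q'⁻¹).val Q'.val, hQ', Matrix.one_mul]
  · intro h
    have := congrArg (fun M => Q'.val * M * (Q⁻¹).val) h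
    simp only [conjDiag, Matrix.mul_assoc, hQ2, Matrix.mul_one] at this ⊢
    rw [← Matrix.mul_assoc Q'.val (Q'⁻¹).val, hQ2', Matrix.one_mul] at this
    exact this

/-- A nonzero entry in the eigenbases joins equal eigenvalues, and these have equal images under
`γ`. -/
lemma conjDiag_intertwine_map {n p : ℕ} {Q : GL (Fin n) ℂ} {c : Fin n → ℂˣ} {Q' : GL (Fin p) ℂ}
    {c' : Fin p → ℂˣ} {F : Matrix (Fin p) (Fin n) ℂ}
    (h : F * conjDiag Q c = conjDiag Q' c' * F) (γ : ℂˣ →* ℂˣ) :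
    F * conjDiag Q (fun i => γ (c i)) = conjDiag Q' (fun i => γ (c' i)) * F := by
  rw [conjDiag_intertwine_iff] at h ⊢
  intro i j
  by_cases h0 : ((Q'⁻¹).val * F * Q.val) i j = 0
  · rw [h0, zero_mul, mul_zero]
  · have h1 := h i j
    rw [mul_comm] at h1
    rw [Units.ext (mul_right_cancel₀ h0 h1), mul_comm]

lemma conjDiag_kron {n m : ℕ} (Q : GL (Fin n) ℂ) (c : Fin n → ℂˣ) (R : GL (Fin m) ℂ)
    (d : Fin m → ℂˣ) :
    conjDiag (kronGL Q R) (fun i => c (finProdFinEquiv.symm i).1 * d (finProdFinEquiv.symm i).2) =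
      kron (conjDiag Q c) (conjDiag R d) := by
  have hd : Matrix.diagonal (fun i => ((c (finProdFinEquiv.symm i).1 *
      d (finProdFinEquiv.symm i).2 : ℂˣ) : ℂ)) =
      kron (Matrix.diagonal (fun i => (c i : ℂ))) (Matrix.diagonal (fun i => (d i : ℂ))) := by
    ext i j
    obtain ⟨⟨i, i'⟩, rfl⟩ := finProdFinEquiv.surjective i
    obtain ⟨⟨j, j'⟩, rfl⟩ := finProdFinEquiv.surjective j
    simp only [kron, Matrix.submatrix_apply, Equiv.symm_apply_apply, Matrix.kroneckerMap_apply,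
      Matrix.diagonal_apply, EmbeddingLike.apply_eq_iff_eq, Prod.mk.injEq, Units.val_mul]
    split_ifs <;> simp_all
  have hi : ((kronGL Q R)⁻¹).val = kron (Q⁻¹).val (R⁻¹).val := rfl
  rw [conjDiag, hd, hi]
  change kron Q.val R.val * _ * _ = _
  rw [kron_mul, kron_mul]
  rfl

/-- A matrix that intertwines two invertible matrices intertwines their semi-simple factors. -/
lemma Dunford.intertwine_semisimple {n p : ℕ} {A : GL (Fin n) ℂ} {B : GL (Fin p) ℂ}
    (D : Dunford A) (E : Dunford B) {F : Matrix (Fin p) (Fin n) ℂ} (h : F * A.val = B.val * F) :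
    F * conjDiag D.Q D.c = conjDiag E.Q E.c * F := by
  set S := conjDiag D.Q D.c with hS
  set T := conjDiag E.Q E.c with hT
  set T' := conjDiag E.Q (E.c⁻¹) with hT'
  have hTT' : T' * T = 1 := by rw [hT', hT, ← conjDiag_mul, inv_mul_cancel, conjDiag_one]
  have hTT'2 : T * T' = 1 := by rw [hT', hT, ← conjDiag_mul, mul_inv_cancel, conjDiag_one]
  have hcT' : Commute T' E.U := by
    have h1 : Commute T E.U := E.commute
    calc T' * E.U = T' * E.U * (T * T') := by rw [hTT'2, mul_one]
      _ = T' * (E.U * T) * T' := by simp only [mul_assoc]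
      _ = T' * T * E.U * T' := by rw [← h1.eq]; simp only [mul_assoc]
      _ = E.U * T' := by rw [hTT', one_mul]
  have hcS : Commute S D.U := D.commute
  -- With `S = A_s` and `T = B_s`, the three commuting operators on `p × n` matrices are `X M = B_u
  -- M`, `Y M = M A_u` and `R M = T⁻¹ M S`. The aim is `R F = F`.
  let X : Module.End ℂ (Matrix (Fin p) (Fin n) ℂ) := mulLeftLinearMap (Fin n) ℂ E.U
  let Y : Module.End ℂ (Matrix (Fin p) (Fin n) ℂ) := mulRightLinearMap (Fin p) ℂ D.U
  let R : Module.End ℂ (Matrix (Fin p) (Fin n) ℂ) :=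
    mulLeftLinearMap (Fin n) ℂ T' * mulRightLinearMap (Fin p) ℂ S
  have hX : ∀ M, X M = E.U * M := fun _ => rfl
  have hY : ∀ M, Y M = M * D.U := fun _ => rfl
  have hR : ∀ M, R M = T' * (M * S) := fun _ => rfl
  have hXY : Commute X Y := LinearMap.ext fun M => by
    change E.U * (M * D.U) = E.U * M * D.U
    rw [Matrix.mul_assoc]
  have hRX : Commute R X := LinearMap.ext fun M => by
    change T' * (E.U * M * S) = E.U * (T' * (M * S))
    rw [Matrix.mul_assoc, ← Matrix.mul_assoc T', ← Matrix.mul_assoc E.U T', hcT'.eq]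
  have hRY : Commute R Y := LinearMap.ext fun M => by
    change T' * (M * D.U * S) = T' * (M * S) * D.U
    rw [Matrix.mul_assoc M, ← hcS.eq]
    simp only [Matrix.mul_assoc]
  -- Both `X - 1` and `Y - 1` are nilpotent, and they commute.
  have hnil : IsNilpotent (X - Y) := by
    have e : X - Y = (X - 1) - (Y - 1) := by abel
    rw [e]
    refine Commute.isNilpotent_sub ?_ ?_ ?_
    · exact (hXY.sub_right (Commute.one_right X)).sub_left (Commute.one_left _)
    · obtain ⟨k, hk⟩ := E.unipotent
      refine ⟨k, ?_⟩
      have : X - 1 = mulLeftLinearMap (Fin n) ℂ (E.U - 1) := LinearMap.ext fun M => by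
        change E.U * M - M = (E.U - 1) * M
        rw [Matrix.sub_mul, Matrix.one_mul]
      rw [this, pow_mulLeftLinearMap, hk]
      exact mulLeftLinearMap_zero_eq_zero _ _
    · obtain ⟨k, hk⟩ := D.unipotent
      refine ⟨k, ?_⟩
      have : Y - 1 = mulRightLinearMap (Fin p) ℂ (D.U - 1) := LinearMap.ext fun M => by
        change M * D.U - M = M * (D.U - 1)
        rw [Matrix.mul_sub, Matrix.mul_one]
      rw [this, pow_mulRightLinearMap, hk]
      exact mulRightLinearMap_zero_eq_zero _ _
  -- The hypothesis `F A = B F` reads `R Y F = X F`.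
  have hF : (X - Y) F = ((R - 1) * Y) F := by
    have h1 : F * (S * D.U) = T * E.U * F := by rw [← D.eq, ← E.eq, h]
    have h2 : T' * (F * S * D.U) = E.U * F := by
      rw [Matrix.mul_assoc F, h1, Matrix.mul_assoc, ← Matrix.mul_assoc T', hTT', Matrix.one_mul]
    change E.U * F - F * D.U = T' * (F * D.U * S) - F * D.U
    rw [← h2, Matrix.mul_assoc F, Matrix.mul_assoc F, hcS.eq]
  have hcomm : Commute (X - Y) ((R - 1) * Y) := by
    refine Commute.mul_right ?_ ?_
    · exact (hRX.symm.sub_right (Commute.one_right _)).sub_left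
        (hRY.symm.sub_right (Commute.one_right _))
    · exact hXY.sub_left (Commute.refl Y)
  -- The two commuting operators agree at `F` only, but commutation lets their powers agree at `F`
  -- as well. Nilpotency of `X - Y` and invertibility of `Y` then give `(R - 1)^k F = 0`.
  have hpow : ∀ k : ℕ, ((X - Y) ^ k) F = (((R - 1) * Y) ^ k) F := by
    intro k
    induction k with
    | zero => rfl
    | succ k ih =>
      rw [pow_succ, Module.End.mul_apply, hF, ← Module.End.mul_apply,
        (hcomm.pow_left k).eq, Module.End.mul_apply, ih, ← Module.End.mul_apply, ← pow_succ']
  obtain ⟨k, hk⟩ := hnil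
  have h0 : ((R - 1) ^ k) F = 0 := by
    have hc : Commute (R - 1) Y := hRY.sub_left (Commute.one_left _)
    have h1 := hpow k
    rw [hk, hc.mul_pow, hc.pow_pow, Module.End.mul_apply] at h1
    have hu : IsUnit D.U := by
      have := D.unipotent.isUnit_one_add
      rwa [add_sub_cancel] at this
    have h2 : (Y ^ k) (((R - 1) ^ k) F) = ((R - 1) ^ k) F * D.U ^ k := by
      change (mulRightLinearMap (Fin p) ℂ D.U ^ k) _ = _
      rw [pow_mulRightLinearMap]
      rfl
    rw [h2] at h1
    obtain ⟨u, hu'⟩ := hu.pow k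
    rw [← hu'] at h1
    calc ((R - 1) ^ k) F = ((R - 1) ^ k) F * (u.val * (u⁻¹).val) := by
          rw [← Units.val_mul, mul_inv_cancel, Units.val_one, Matrix.mul_one]
      _ = 0 := by rw [← Matrix.mul_assoc, ← h1, LinearMap.zero_apply, Matrix.zero_mul]
  -- `R` is diagonal in the eigenbases, with eigenvalues `c_j / c'_i`; for a diagonalizable operator
  -- `(R - 1)^k F = 0` already implies `(R - 1) F = 0`.
  have hentry : ∀ (M : Matrix (Fin p) (Fin n) ℂ) i j,
      ((E.Q⁻¹).val * ((R - 1) M) * D.Q.val) i j =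
        ((E.c i : ℂ)⁻¹ * D.c j - 1) * ((E.Q⁻¹).val * M * D.Q.val) i j := by
    intro M i j
    have hQ : (D.Q⁻¹).val * D.Q.val = 1 := by rw [← Units.val_mul, inv_mul_cancel, Units.val_one]
    have hQ' : (E.Q⁻¹).val * E.Q.val = 1 := by rw [← Units.val_mul, inv_mul_cancel, Units.val_one]
    have e : (E.Q⁻¹).val * ((R - 1) M) * D.Q.val =
        Matrix.diagonal (fun i => ((E.c⁻¹) i : ℂ)) * ((E.Q⁻¹).val * M * D.Q.val) *
          Matrix.diagonal (fun i => (D.c i : ℂ)) - (E.Q⁻¹).val * M * D.Q.val := by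
      rw [LinearMap.sub_apply, hR, Module.End.one_apply, Matrix.mul_sub, Matrix.sub_mul]
      congr 1
      simp only [hT', hS, conjDiag, Matrix.mul_assoc, hQ, Matrix.mul_one]
      rw [← Matrix.mul_assoc (E.Q⁻¹).val E.Q.val, hQ', Matrix.one_mul]
    rw [e, Matrix.sub_apply, Matrix.mul_diagonal, Matrix.diagonal_mul, Pi.inv_apply,
      Units.val_inv_eq_inv_val]
    ring
  have hentry' : ∀ k i j, ((E.Q⁻¹).val * (((R - 1) ^ k) F) * D.Q.val) i j =
        ((E.c i : ℂ)⁻¹ * D.c j - 1) ^ k * ((E.Q⁻¹).val * F * D.Q.val) i j := by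
    intro k i j
    induction k with
    | zero => simp
    | succ k ih => rw [pow_succ', Module.End.mul_apply, hentry, ih, pow_succ', mul_assoc]
  rw [hS, hT, conjDiag_intertwine_iff]
  intro i j
  have h3 := hentry' k i j
  rw [h0, Matrix.mul_zero, Matrix.zero_mul, Matrix.zero_apply] at h3
  rcases mul_eq_zero.1 h3.symm with h4 | h4
  · have h5 := eq_zero_of_pow_eq_zero h4
    have h6 : (E.c i : ℂ) ≠ 0 := (E.c i).ne_zero
    have h7 : (D.c j : ℂ) = E.c i := by
      rw [sub_eq_zero, inv_mul_eq_one₀ h6] at h5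
      exact h5.symm
    rw [h7, mul_comm]
  · rw [h4, zero_mul, mul_zero]

/-- The invertible semi-simple factor cancels from `F A_s A_u = B_s B_u F`. -/
lemma Dunford.intertwine_unipotent {n p : ℕ} {A : GL (Fin n) ℂ} {B : GL (Fin p) ℂ}
    (D : Dunford A) (E : Dunford B) {F : Matrix (Fin p) (Fin n) ℂ} (h : F * A.val = B.val * F) :
    F * D.U = E.U * F := by
  have h1 := D.intertwine_semisimple E h
  have h2 : conjDiag E.Q E.c⁻¹ * conjDiag E.Q E.c = 1 := by
    rw [← conjDiag_mul, inv_mul_cancel, conjDiag_one]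
  calc F * D.U = conjDiag E.Q E.c⁻¹ * conjDiag E.Q E.c * (F * D.U) := by rw [h2, Matrix.one_mul]
    _ = conjDiag E.Q E.c⁻¹ * (F * (conjDiag D.Q D.c * D.U)) := by
      rw [Matrix.mul_assoc, ← Matrix.mul_assoc _ F, ← h1, Matrix.mul_assoc]
    _ = conjDiag E.Q E.c⁻¹ * conjDiag E.Q E.c * (E.U * F) := by
      rw [← D.eq, h, E.eq]
      simp only [Matrix.mul_assoc]
    _ = E.U * F := by rw [h2, Matrix.one_mul]

/-- `A ↦ A^(γ, t)` is natural. -/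
lemma Dunford.act_intertwine {n p : ℕ} {A : GL (Fin n) ℂ} {B : GL (Fin p) ℂ}
    (D : Dunford A) (E : Dunford B) {F : Matrix (Fin p) (Fin n) ℂ} (h : F * A.val = B.val * F)
    (g : ZAlg) : F * D.act g = E.act g * F := by
  rw [Dunford.act, Dunford.act, ← Matrix.mul_assoc,
    conjDiag_intertwine_map (D.intertwine_semisimple E h), Matrix.mul_assoc,
    unipPow_intertwine D.unipotent E.unipotent (D.intertwine_unipotent E h), Matrix.mul_assoc]

/-- `A^(γ, t)` does not depend on the choices. -/
lemma Dunford.act_eq {n : ℕ} {A : GL (Fin n) ℂ} (D E : Dunford A) (g : ZAlg) :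
    D.act g = E.act g := by
  simpa using D.act_intertwine E (F := 1) (by simp) g

lemma Dunford.act_one {n : ℕ} {A : GL (Fin n) ℂ} (D : Dunford A) : D.act 1 = 1 := by
  have : (fun i => (1 : ZAlg).1 (D.c i)) = 1 := rfl
  rw [Dunford.act, this, conjDiag_one, Matrix.one_mul]
  exact unipPow_zero_right D.unipotent

lemma Dunford.act_mul {n : ℕ} {A : GL (Fin n) ℂ} (D : Dunford A) (g h : ZAlg) :
    D.act (g * h) = D.act g * D.act h := by
  have e : (fun i => (g * h).1 (D.c i)) = (fun i => g.1 (D.c i)) * fun i => h.1 (D.c i) := rfl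
  have e' : (g * h).2.toAdd = g.2.toAdd + h.2.toAdd := rfl
  have hc : conjDiag D.Q (fun i => h.1 (D.c i)) * unipPow D.U g.2.toAdd =
      unipPow D.U g.2.toAdd * conjDiag D.Q (fun i => h.1 (D.c i)) :=
    unipPow_intertwine D.unipotent D.unipotent
      (conjDiag_intertwine_map D.commute.symm.eq h.1).symm _
  rw [Dunford.act, Dunford.act, Dunford.act, e, e', conjDiag_mul, unipPow_add D.unipotent]
  simp only [Matrix.mul_assoc]
  rw [← Matrix.mul_assoc (conjDiag D.Q fun i => h.1 (D.c i)), hc, Matrix.mul_assoc]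

/-- The tensor product of two Dunford decompositions. -/
noncomputable def Dunford.kron {n m : ℕ} {A : GL (Fin n) ℂ} {B : GL (Fin m) ℂ} (D : Dunford A)
    (E : Dunford B) : Dunford (kronGL A B) where
  Q := kronGL D.Q E.Q
  c i := D.c (finProdFinEquiv.symm i).1 * E.c (finProdFinEquiv.symm i).2
  U := LocalGalois.kron D.U E.U
  unipotent := kron_sub_one_isNilpotent D.unipotent E.unipotent
  commute := by
    rw [conjDiag_kron]
    change _ * _ = _ * _
    rw [kron_mul, kron_mul, D.commute.eq, E.commute.eq]
  eq := by
    rw [conjDiag_kron, kron_mul, ← D.eq, ← E.eq]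
    rfl

lemma Dunford.kron_act {n m : ℕ} {A : GL (Fin n) ℂ} {B : GL (Fin m) ℂ} (D : Dunford A)
    (E : Dunford B) (g : ZAlg) :
    (D.kron E).act g = LocalGalois.kron (D.act g) (E.act g) := by
  rw [Dunford.act, Dunford.act, Dunford.act, ← kron_mul, ← conjDiag_kron,
    ← unipPow_kron D.unipotent E.unipotent]
  simp only [Dunford.kron, map_mul]

/-- The Dunford decomposition of a scalar multiple. -/
noncomputable def Dunford.smul {n : ℕ} {A : GL (Fin n) ℂ} (D : Dunford A) (u : ℂˣ) :
    Dunford (u • A) where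
  Q := D.Q
  c i := u * D.c i
  U := D.U
  unipotent := D.unipotent
  commute := by
    rw [conjDiag_smul]
    exact D.commute.smul_left _
  eq := by
    rw [conjDiag_smul, Matrix.smul_mul, ← D.eq]
    rfl

lemma Dunford.smul_act {n : ℕ} {A : GL (Fin n) ℂ} (D : Dunford A) (u : ℂˣ) (g : ZAlg) :
    (D.smul u).act g = (g.1 u : ℂ) • D.act g := by
  simp only [Dunford.act, Dunford.smul, map_mul]
  rw [conjDiag_smul, Matrix.smul_mul]

end SemisimpleFactor
end LocalGalois

namespace LocalGalois

open CategoryTheory MonoidalCategory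

/-! ### From pairs `(γ, t)` to tensor automorphisms of the forgetful functor. -/

section TensorAutomorphisms

/-- The matrix `A^(γ, t)` on `(ℂ^n, A)`. -/
noncomputable def actMat (g : ZAlg) {n : ℕ} (A : GL (Fin n) ℂ) : Matrix (Fin n) (Fin n) ℂ :=
  (nonempty_dunford A).some.act g

lemma Dunford.act_eq_actMat {n : ℕ} {A : GL (Fin n) ℂ} (D : Dunford A) (g : ZAlg) :
    D.act g = actMat g A := D.act_eq _ g

lemma actMat_one {n : ℕ} (A : GL (Fin n) ℂ) : actMat 1 A = 1 := Dunford.act_one _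

lemma actMat_mul {n : ℕ} (A : GL (Fin n) ℂ) (g h : ZAlg) :
    actMat (g * h) A = actMat g A * actMat h A := Dunford.act_mul _ g h

lemma actMat_intertwine {n p : ℕ} {A : GL (Fin n) ℂ} {B : GL (Fin p) ℂ}
    {F : Matrix (Fin p) (Fin n) ℂ} (h : F * A.val = B.val * F) (g : ZAlg) :
    F * actMat g A = actMat g B * F := Dunford.act_intertwine _ _ h g

/-- The decomposition chosen for `kronGL A B` need not be the tensor product of the chosen ones;
independence of the choice allows the exchange. -/
lemma actMat_kronGL {n m : ℕ} (A : GL (Fin n) ℂ) (B : GL (Fin m) ℂ) (g : ZAlg) :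
    actMat g (kronGL A B) = kron (actMat g A) (actMat g B) := by
  rw [← Dunford.act_eq_actMat (Dunford.kron (nonempty_dunford A).some (nonempty_dunford B).some),
    Dunford.kron_act]
  rfl

/-- A scalar affects only the eigenvalues. This is the source of the powers of `γ(q)` when Taylor
coefficients intertwine `q^m A` with `q^M B`. -/
lemma actMat_smul {n : ℕ} (A : GL (Fin n) ℂ) (u : ℂˣ) (g : ZAlg) :
    actMat g (u • A) = (g.1 u : ℂ) • actMat g A := by
  rw [← Dunford.act_eq_actMat (Dunford.smul (nonempty_dunford A).some u), Dunford.smul_act]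
  rfl

/-- The trivial Dunford decomposition of the identity. -/
noncomputable def Dunford.one (n : ℕ) : Dunford (1 : GL (Fin n) ℂ) where
  Q := 1
  c := 1
  U := 1
  unipotent := by rw [sub_self]; exact IsNilpotent.zero
  commute := Commute.one_right _
  eq := by rw [conjDiag_one]; simp

lemma actMat_one_right (n : ℕ) (g : ZAlg) : actMat g (1 : GL (Fin n) ℂ) = 1 := by
  have h0 : IsNilpotent ((1 : Matrix (Fin n) (Fin n) ℂ) - 1) := by
    rw [sub_self]; exact IsNilpotent.zero
  rw [← (Dunford.one n).act_eq_actMat, Dunford.act]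
  have h1 : (fun i => g.1 ((Dunford.one n).c i)) = 1 := funext fun _ => map_one g.1
  have h2 : unipPow (1 : Matrix (Fin n) (Fin n) ℂ) g.2.toAdd = 1 := by
    rw [unipPow_eq_sum h0 _ (Nat.le_succ n), Finset.sum_range_succ', Finset.sum_eq_zero]
    · simp
    · intro k _
      rw [sub_self, pow_succ, mul_zero, smul_zero]
  rw [h1, conjDiag_one, Matrix.one_mul]
  exact h2

/-- The isomorphism of `ℂ^n` given by `A^(γ, t)`. -/
noncomputable def actIso (g : ZAlg) {n : ℕ} (A : GL (Fin n) ℂ) :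
    (⟨n⟩ : MatCat ℂ) ≅ ⟨n⟩ where
  hom := actMat g A
  inv := actMat g⁻¹ A
  hom_inv_id := by
    rw [matCat_comp]
    exact ((actMat_mul A g⁻¹ g).symm.trans
      (congrArg (actMat · A) (inv_mul_cancel g))).trans (actMat_one A)
  inv_hom_id := by
    rw [matCat_comp]
    exact ((actMat_mul A g g⁻¹).symm.trans
      (congrArg (actMat · A) (mul_inv_cancel g))).trans (actMat_one A)

/-- `(γ, t)` acts on the forgetful functor by tensor automorphisms. -/
noncomputable def actAut (g : ZAlg) : TensorAut :=
  LaxMonoidalFunctor.isoOfComponents (fun X => actIso g X.A)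
    (fun {X Y} F => by
      have h : FlatSys.matrix F * X.A.val = Y.A.val * FlatSys.matrix F := F.comm
      exact (actMat_intertwine h g).symm)
    (by
      have h : actMat g (1 : GL (Fin 1) ℂ) * (1 : Matrix (Fin 1) (Fin 1) ℂ) = 1 := by
        rw [actMat_one_right, Matrix.one_mul]
      exact h)
    (fun X Y => by
      have h : actMat g (kronGL X.A Y.A) * 1 = 1 * kron (actMat g X.A) (actMat g Y.A) := by
        rw [actMat_kronGL, Matrix.one_mul, Matrix.mul_one]
      exact h)

/-- The component at `(ℂ^n, A)` of a tensor automorphism. -/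
def TensorAut.mat (η : TensorAut) {n : ℕ} (A : GL (Fin n) ℂ) : Matrix (Fin n) (Fin n) ℂ :=
  η.hom.hom.app (⟨n, A⟩ : RepZ)

lemma TensorAut.ext_mat {η θ : TensorAut}
    (h : ∀ (n : ℕ) (A : GL (Fin n) ℂ), TensorAut.mat η A = TensorAut.mat θ A) : η = θ := by
  refine Iso.ext (LaxMonoidalFunctor.hom_ext (NatTrans.ext (funext fun X => ?_)))
  exact h X.rank X.A

lemma TensorAut.mat_intertwine (η : TensorAut) {n p : ℕ} {A : GL (Fin n) ℂ} {B : GL (Fin p) ℂ}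
    {F : Matrix (Fin p) (Fin n) ℂ} (h : F * A.val = B.val * F) :
    F * TensorAut.mat η A = TensorAut.mat η B * F := by
  let F' : (⟨n, A⟩ : RepZ) ⟶ ⟨p, B⟩ := FlatSys.Hom.mk F h
  exact (η.hom.hom.naturality F').symm

lemma TensorAut.mat_one (η : TensorAut) : TensorAut.mat η (1 : GL (Fin 1) ℂ) = 1 := by
  have h : TensorAut.mat η (1 : GL (Fin 1) ℂ) * (1 : Matrix (Fin 1) (Fin 1) ℂ) = 1 :=
    η.hom.isMonoidal.unit
  rwa [Matrix.mul_one] at h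

lemma TensorAut.mat_kronGL (η : TensorAut) {n m : ℕ} (A : GL (Fin n) ℂ) (B : GL (Fin m) ℂ) :
    TensorAut.mat η (kronGL A B) = kron (TensorAut.mat η A) (TensorAut.mat η B) := by
  have h : TensorAut.mat η (kronGL A B) * (1 : Matrix (Fin (n * m)) (Fin (n * m)) ℂ) =
      1 * kron (TensorAut.mat η A) (TensorAut.mat η B) :=
    η.hom.isMonoidal.tensor (⟨n, A⟩ : RepZ) ⟨m, B⟩
  rwa [Matrix.mul_one, Matrix.one_mul] at h

/-- Multiplication in `Aut` reverses composition, and composition in `MatCat` reverses the matrix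
product; the two reversals cancel. -/
lemma TensorAut.mat_mul (η θ : TensorAut) {n : ℕ} (A : GL (Fin n) ℂ) :
    TensorAut.mat (η * θ) A = TensorAut.mat η A * TensorAut.mat θ A := rfl

lemma actAut_mat (g : ZAlg) {n : ℕ} (A : GL (Fin n) ℂ) :
    TensorAut.mat (actAut g) A = actMat g A := rfl

/-- The action as a homomorphism. -/
noncomputable def actHom : ZAlg →* TensorAut where
  toFun := actAut
  map_one' := TensorAut.ext_mat fun n A => by
    rw [actAut_mat, actMat_one]
    rfl
  map_mul' g h := TensorAut.ext_mat fun n A => by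
    rw [TensorAut.mat_mul, actAut_mat, actAut_mat, actAut_mat, actMat_mul]

end TensorAutomorphisms
end LocalGalois

namespace LocalGalois

open CategoryTheory MonoidalCategory

/-! ### Jordan blocks as shift operators on spaces of polynomials. -/

section JordanBlocks

/-- The Jordan block `c (1 + N)` of size `d`. -/
def jordan (c : ℂ) (d : ℕ) : Matrix (Fin d) (Fin d) ℂ :=
  Matrix.of fun i j => c * ((if j.val = i.val then 1 else 0) + if i.val + 1 = j.val then 1 else 0)

/-- The row is the restriction of a function `G` on all of `ℕ`, so that the neighbouring index `j -
1` makes sense without bounds; the case `j = 0` is where the off-diagonal term disappears. -/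
lemma sum_mul_jordan (c : ℂ) {d : ℕ} (G : ℕ → ℂ) (j : Fin d) :
    ∑ i : Fin d, G i * jordan c d i j = c * (G j + if j.val = 0 then 0 else G (j.val - 1)) := by
  have h1 : ∑ i : Fin d, G i * (if j.val = i.val then 1 else 0) = G j := by
    simp only [← Fin.ext_iff, mul_ite, mul_one, mul_zero, Finset.sum_ite_eq, Finset.mem_univ, if_true]
  have h2 : ∑ i : Fin d, G i * (if i.val + 1 = j.val then 1 else 0) =
      if j.val = 0 then 0 else G (j.val - 1) := by
    split_ifs with h
    · exact Finset.sum_eq_zero fun i _ => by rw [if_neg (by omega), mul_zero]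
    · rw [Finset.sum_eq_single (⟨j.val - 1, by omega⟩ : Fin d)]
      · rw [if_pos (by simp only; omega), mul_one]
      · intro i _ hi
        rw [if_neg (fun h' => hi (Fin.ext (by simp only; omega))), mul_zero]
      · exact fun h' => absurd (Finset.mem_univ _) h'
  rw [← h2]
  conv_rhs => rw [← h1]
  rw [← Finset.sum_add_distrib, Finset.mul_sum]
  refine Finset.sum_congr rfl fun i _ => ?_
  simp only [jordan, Matrix.of_apply]
  ring

lemma sum_jordan_mul (c : ℂ) {d : ℕ} (G : ℕ → ℂ) (i : Fin d) :
    ∑ j : Fin d, jordan c d i j * G j = c * (G i + if i.val + 1 < d then G (i.val + 1) else 0) := by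
  have h1 : ∑ j : Fin d, (if j.val = i.val then 1 else 0) * G j = G i := by
    simp only [← Fin.ext_iff, ite_mul, one_mul, zero_mul, Finset.sum_ite_eq', Finset.mem_univ, if_true]
  have h2 : ∑ j : Fin d, (if i.val + 1 = j.val then 1 else 0) * G j =
      if i.val + 1 < d then G (i.val + 1) else 0 := by
    split_ifs with h
    · rw [Finset.sum_eq_single (⟨i.val + 1, h⟩ : Fin d)]
      · rw [if_pos rfl, one_mul]
      · intro j _ hj
        rw [if_neg (fun h' => hj (Fin.ext h'.symm)), zero_mul]
      · exact fun h' => absurd (Finset.mem_univ _) h'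
    · exact Finset.sum_eq_zero fun j _ => by rw [if_neg (by omega), zero_mul]
  rw [← h2]
  conv_rhs => rw [← h1]
  rw [← Finset.sum_add_distrib, Finset.mul_sum]
  refine Finset.sum_congr rfl fun i _ => ?_
  simp only [jordan, Matrix.of_apply]
  ring

lemma det_jordan (c : ℂ) (d : ℕ) : (jordan c d).det = c ^ d := by
  rw [Matrix.det_of_isUpperTriangular]
  · simp [jordan]
  · intro i j hij
    have hij' : j.val < i.val := hij
    simp only [jordan, Matrix.of_apply]
    rw [if_neg (by omega), if_neg (by omega)]
    simp

/-- The Jordan block with a non-zero eigenvalue as an invertible matrix. -/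
noncomputable def jordanGL (c : ℂˣ) (d : ℕ) : GL (Fin d) ℂ :=
  Matrix.GeneralLinearGroup.mkOfDetNeZero (jordan c d)
    (by rw [det_jordan]; exact pow_ne_zero _ c.ne_zero)

lemma jordanGL_val (c : ℂˣ) (d : ℕ) : (jordanGL c d).val = jordan c d := rfl

/-- The multiplication of polynomials of degree less than `d` by those of degree less than `2`, in
the bases of binomial polynomials. -/
def binomMul (d : ℕ) : Matrix (Fin (d + 1)) (Fin (d * 2)) ℂ :=
  Matrix.of fun i x =>
    if (finProdFinEquiv.symm x).2.val = 0 then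
      if i.val = (finProdFinEquiv.symm x).1.val then 1 else 0
    else
      ((finProdFinEquiv.symm x).1.val + 1) *
        (if i.val = (finProdFinEquiv.symm x).1.val + 1 then 1 else 0) +
      (finProdFinEquiv.symm x).1.val * (if i.val = (finProdFinEquiv.symm x).1.val then 1 else 0)

/-- In the basis `binom(x, j)`, Pascal's rule makes `jordan c d` the operator `f(x) ↦ c f(x + 1)`.
The shift is multiplicative, so it commutes with the multiplication of polynomials, which is given
here by `x · binom(x, m) = (m + 1) binom(x, m + 1) + m binom(x, m)`. -/
lemma binomMul_intertwine (c : ℂ) (d : ℕ) :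
    binomMul d * kron (jordan c d) (jordan 1 2) = jordan c (d + 1) * binomMul d := by
  ext i x
  obtain ⟨⟨m, b⟩, rfl⟩ := finProdFinEquiv.surjective x
  let G : ℕ → ℕ → ℕ → ℂ := fun b m i =>
    if b = 0 then if i = m then 1 else 0
    else ((m : ℂ) + 1) * (if i = m + 1 then 1 else 0) + m * (if i = m then 1 else 0)
  have hG : ∀ (i : Fin (d + 1)) (m : Fin d) (b : Fin 2),
      binomMul d i (finProdFinEquiv (m, b)) = G b m i := by
    intro i m b
    simp only [binomMul, Matrix.of_apply, Equiv.symm_apply_apply, G]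
  have hl : (binomMul d * kron (jordan c d) (jordan 1 2)) i (finProdFinEquiv (m, b)) =
      ∑ m' : Fin d, (∑ b' : Fin 2, G b' m' i * jordan 1 2 b' b) * jordan c d m' m := by
    rw [Matrix.mul_apply, ← finProdFinEquiv.sum_comp, Fintype.sum_prod_type]
    refine Finset.sum_congr rfl fun m' _ => ?_
    rw [Finset.sum_mul]
    refine Finset.sum_congr rfl fun b' _ => ?_
    rw [hG]
    simp only [kron, Matrix.submatrix_apply, Equiv.symm_apply_apply, Matrix.kroneckerMap_apply]
    ring
  have hr : (jordan c (d + 1) * binomMul d) i (finProdFinEquiv (m, b)) =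
      ∑ k : Fin (d + 1), jordan c (d + 1) i k * G b m k := by
    rw [Matrix.mul_apply]
    exact Finset.sum_congr rfl fun k _ => by rw [hG]
  rw [hl, hr, sum_jordan_mul]
  simp_rw [fun m' : Fin d => sum_mul_jordan 1 (fun b' => G b' m' i) b]
  rw [sum_mul_jordan c (fun m' => 1 * (G b m' i + if b.val = 0 then 0 else G (b.val - 1) m' i))]
  have hi := i.2
  have hm := m.2
  congr 1
  obtain ⟨i, hi'⟩ := i
  obtain ⟨m, hm'⟩ := m
  -- What remains is an identity between indicator functions of `i`, checked separately for the
  -- factors `1` and `x` and for `m` zero or not.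
  fin_cases b <;> rcases m with _ | m <;> simp only [G] <;> push_cast <;>
    split_ifs <;> first | (exfalso; omega) | (simp; done) | (simp; ring)

/-- The multiplication map is surjective for `d ≥ 1`: each `binom(x, m)` with `m < d` is its own
product with `1`, and `binom(x, d)` comes from `x · binom(x, d - 1)`. For `d = 0` the source is zero
and the target is not. -/
lemma eq_zero_of_mul_binomMul {d : ℕ} (hd : d ≠ 0) {p : ℕ} {M : Matrix (Fin p) (Fin (d + 1)) ℂ}
    (h : M * binomMul d = 0) : M = 0 := by
  have h0 : ∀ a (m : Fin d), M a m.castSucc = 0 := by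
    intro a m
    have := congrFun (congrFun h a) (finProdFinEquiv (m, 0))
    rw [Matrix.mul_apply, Finset.sum_eq_single m.castSucc] at this
    · simpa [binomMul] using this
    · intro k _ hk
      have : k.val ≠ m.val := fun h' => hk (Fin.ext h')
      simp [binomMul, this]
    · exact fun h' => absurd (Finset.mem_univ _) h'
  ext a k
  refine Fin.lastCases ?_ (fun m => h0 a m) k
  -- The column of `x · binom(x, d - 1)` has the nonzero coefficient `d` on `binom(x, d)`; its other
  -- coefficient meets a column of `M` already known to vanish.
  have := congrFun (congrFun h a) (finProdFinEquiv (⟨d - 1, by omega⟩, 1))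
  rw [Matrix.mul_apply, Fin.sum_univ_castSucc, Finset.sum_eq_zero (fun m _ => by rw [h0, zero_mul]),
    zero_add] at this
  have hne : d ≠ d - 1 := by omega
  have hs : ((d - 1 : ℕ) : ℂ) + 1 ≠ 0 := Nat.cast_add_one_ne_zero _
  have he : d - 1 + 1 = d := by omega
  simp only [binomMul, Matrix.of_apply, Equiv.symm_apply_apply, Fin.val_last, he, hne] at this
  simpa [hs] using this

end JordanBlocks

/-! ### Tensor automorphisms are determined by rank one objects and the block of size 2. -/

section Generators

/-- Induction on the size: the component on the next block is determined by that on the tensor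
product, because `binomMul` is an epimorphism. -/
lemma TensorAut.mat_jordanGL_eq {η θ : TensorAut}
    (h1 : ∀ c : ℂˣ, TensorAut.mat η (jordanGL c 1) = TensorAut.mat θ (jordanGL c 1))
    (h2 : TensorAut.mat η (jordanGL 1 2) = TensorAut.mat θ (jordanGL 1 2)) (c : ℂˣ) (d : ℕ) :
    TensorAut.mat η (jordanGL c (d + 1)) = TensorAut.mat θ (jordanGL c (d + 1)) := by
  induction d with
  | zero => exact h1 c
  | succ d ih =>
    have h : binomMul (d + 1) * (kronGL (jordanGL c (d + 1)) (jordanGL 1 2)).val =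
        (jordanGL c (d + 1 + 1)).val * binomMul (d + 1) := binomMul_intertwine c (d + 1)
    have hη := TensorAut.mat_intertwine η h
    have hθ := TensorAut.mat_intertwine θ h
    rw [TensorAut.mat_kronGL, ih, h2, ← TensorAut.mat_kronGL, hθ] at hη
    refine sub_eq_zero.1 (eq_zero_of_mul_binomMul (Nat.succ_ne_zero d) ?_)
    rw [Matrix.sub_mul, hη, sub_self]

/-- The morphism from a Jordan block defined by an eigenvector of the semi-simple factor. -/
noncomputable def Dunford.string {n : ℕ} {A : GL (Fin n) ℂ} (D : Dunford A) (i : Fin n) :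
    Matrix (Fin n) (Fin (n + 1)) ℂ :=
  Matrix.of fun a m => ((D.U - 1) ^ (n - m.val) * D.Q.val) a i

lemma Dunford.string_last {n : ℕ} {A : GL (Fin n) ℂ} (D : Dunford A) (i a : Fin n) :
    D.string i a (Fin.last n) = D.Q.val a i := by
  simp [Dunford.string]

/-- With `N = A_u - 1` and `v` an eigenvector of `A_s` for `c`, the columns are `N^(n - m) v`, and
`A N^k v = c (N^k v + N^(k+1) v)` is the action of the Jordan block. -/
lemma Dunford.string_intertwine {n : ℕ} {A : GL (Fin n) ℂ} (D : Dunford A) (i : Fin n) :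
    D.string i * (jordanGL (D.c i) (n + 1)).val = A.val * D.string i := by
  have hQ : (D.Q⁻¹).val * D.Q.val = 1 := by rw [← Units.val_mul, inv_mul_cancel, Units.val_one]
  have hS : conjDiag D.Q D.c * D.Q.val = D.Q.val * Matrix.diagonal (fun i => (D.c i : ℂ)) := by
    rw [conjDiag, Matrix.mul_assoc, hQ, Matrix.mul_one]
  have hc : Commute (conjDiag D.Q D.c) (D.U - 1) := D.commute.sub_right (Commute.one_right _)
  have hA : ∀ k : ℕ, A.val * ((D.U - 1) ^ k * D.Q.val) =
      ((D.U - 1) ^ k + (D.U - 1) ^ (k + 1)) * D.Q.val *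
        Matrix.diagonal (fun i => (D.c i : ℂ)) := by
    intro k
    have e : A.val = conjDiag D.Q D.c * ((D.U - 1) + 1) := by rw [sub_add_cancel, ← D.eq]
    have e2 : ((D.U - 1) + 1) * (D.U - 1) ^ k = (D.U - 1) ^ k + (D.U - 1) ^ (k + 1) := by
      rw [add_mul, one_mul, pow_succ', add_comm]
    rw [Matrix.mul_assoc _ D.Q.val, ← hS, ← Matrix.mul_assoc, ← Matrix.mul_assoc, e,
      mul_assoc (conjDiag D.Q D.c), e2, ((hc.pow_right k).add_right (hc.pow_right (k + 1))).eq]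
  ext a m
  rw [jordanGL_val, Matrix.mul_apply]
  have h1 := sum_mul_jordan (D.c i : ℂ) (fun m => ((D.U - 1) ^ (n - m) * D.Q.val) a i) m
  have h2 : (A.val * D.string i) a m = (A.val * ((D.U - 1) ^ (n - m.val) * D.Q.val)) a i := by
    rw [Matrix.mul_apply, Matrix.mul_apply]
    rfl
  refine h1.trans (Eq.trans ?_ h2.symm)
  rw [hA, Matrix.mul_diagonal, add_mul, Matrix.add_apply, mul_comm]
  congr 2
  split_ifs with h0
  -- At the first column the block has no preceding vector, which is consistent because `N^(n+1) =
  -- 0`.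
  · rw [pow_eq_zero_of_isNilpotent D.unipotent (by omega), Matrix.zero_mul, Matrix.zero_apply]
  · have : n - (m.val - 1) = n - m.val + 1 := by omega
    rw [this]

/-- A tensor automorphism is determined by its components on the objects of rank one and on the
unipotent Jordan block of size two. -/
lemma TensorAut.ext_of_generators {η θ : TensorAut}
    (h1 : ∀ c : ℂˣ, TensorAut.mat η (jordanGL c 1) = TensorAut.mat θ (jordanGL c 1))
    (h2 : TensorAut.mat η (jordanGL 1 2) = TensorAut.mat θ (jordanGL 1 2)) : η = θ := by
  refine TensorAut.ext_mat fun n A => ?_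
  obtain ⟨D⟩ := nonempty_dunford A
  have h : TensorAut.mat η A * D.Q.val = TensorAut.mat θ A * D.Q.val := by
    ext a i
    have hη := TensorAut.mat_intertwine η (D.string_intertwine i)
    rw [TensorAut.mat_jordanGL_eq h1 h2, TensorAut.mat_intertwine θ (D.string_intertwine i)] at hη
    -- The last column of the string is the eigenvector itself; as `i` varies, these columns make up
    -- the invertible matrix `Q`.
    have := congrFun (congrFun hη a) (Fin.last n)
    simp only [Matrix.mul_apply, Dunford.string_last] at this ⊢
    exact this.symm
  exact D.Q.isUnit.mul_right_cancel h

/-- The block is an extension of the unit by the unit. Naturality for the inclusion fixes the first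
column, and for the projection the last row. -/
lemma TensorAut.mat_jordanGL_two (η : TensorAut) :
    TensorAut.mat η (jordanGL 1 2) = !![1, TensorAut.mat η (jordanGL 1 2) 0 1; 0, 1] := by
  have hi : !![(1 : ℂ); 0] * (1 : GL (Fin 1) ℂ).val = (jordanGL 1 2).val * !![(1 : ℂ); 0] := by
    rw [jordanGL_val]
    ext i j
    fin_cases i <;> fin_cases j <;> simp [jordan, Matrix.mul_apply]
  have hp : !![(0 : ℂ), 1] * (jordanGL 1 2).val = (1 : GL (Fin 1) ℂ).val * !![(0 : ℂ), 1] := by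
    rw [jordanGL_val]
    ext i j
    fin_cases i
    fin_cases j <;> simp [jordan, Matrix.mul_apply]
  have h1 := TensorAut.mat_intertwine η hi
  have h2 := TensorAut.mat_intertwine η hp
  rw [TensorAut.mat_one] at h1 h2
  have h00 := congrFun (congrFun h1 0) 0
  have h10 := congrFun (congrFun h1 1) 0
  have h11 := congrFun (congrFun h2 0) 1
  simp [Matrix.mul_apply] at h00 h10 h11
  ext i j
  fin_cases i <;> fin_cases j <;> simp [← h00, ← h10, h11]

lemma jordanGL_one_right (c : ℂˣ) : jordanGL c 1 = c • (1 : GL (Fin 1) ℂ) := by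
  refine Units.ext ?_
  rw [jordanGL_val]
  ext i j
  fin_cases i
  fin_cases j
  simp [jordan, Units.smul_def]

lemma actMat_jordanGL_one (g : ZAlg) (c : ℂˣ) : actMat g (jordanGL c 1) 0 0 = g.1 c := by
  rw [jordanGL_one_right, actMat_smul, actMat_one_right]
  simp

lemma jordan_two_sub_one_isNilpotent : IsNilpotent (jordan 1 2 - 1) := by
  refine ⟨2, ?_⟩
  ext i j
  fin_cases i <;> fin_cases j <;> simp [jordan, pow_two, Matrix.mul_apply]

/-- The Dunford decomposition of the unipotent Jordan block of size two. -/
noncomputable def Dunford.jordanTwo : Dunford (jordanGL 1 2) where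
  Q := 1
  c := 1
  U := jordan 1 2
  unipotent := jordan_two_sub_one_isNilpotent
  commute := by rw [conjDiag_one]; exact Commute.one_left _
  eq := by rw [conjDiag_one, Matrix.one_mul]; rfl

lemma actMat_jordanGL_two (g : ZAlg) : actMat g (jordanGL 1 2) 0 1 = g.2.toAdd := by
  have h1 : (fun i => g.1 (Dunford.jordanTwo.c i)) = 1 := funext fun _ => map_one g.1
  have h2 : unipPow (jordan 1 2) g.2.toAdd 0 1 = g.2.toAdd := by
    simp [unipPow, Finset.sum_range_succ, jordan]
  rw [← Dunford.jordanTwo.act_eq_actMat, Dunford.act, h1, conjDiag_one, Matrix.one_mul]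
  exact h2

lemma kronGL_jordanGL_one (c d : ℂˣ) :
    kronGL (jordanGL c 1) (jordanGL d 1) = jordanGL (c * d) 1 := by
  refine Units.ext (Matrix.ext fun i j => ?_)
  change kron (jordan c 1) (jordan d 1) i j = jordan (c * d) 1 i j
  have hi : i = 0 := Subsingleton.elim (α := Fin 1) _ _
  have hj : j = 0 := Subsingleton.elim (α := Fin 1) _ _
  subst hi hj
  simp [kron, jordan]

/-- The character `c ↦ η_{(ℂ, c)}` defined by a tensor automorphism. -/
noncomputable def TensorAut.character (η : TensorAut) : ℂˣ →* ℂˣ :=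
  MonoidHom.toHomUnits
    { toFun := fun c => TensorAut.mat η (jordanGL c 1) 0 0
      map_one' := by
        rw [jordanGL_one_right, one_smul, TensorAut.mat_one]
        rfl
      map_mul' := fun c d => by
        have h := TensorAut.mat_kronGL η (jordanGL c 1) (jordanGL d 1)
        rw [kronGL_jordanGL_one] at h
        exact congrFun (congrFun h 0) 0 }

lemma actHom_injective : Function.Injective actHom := by
  intro g h hgh
  have hm : ∀ {n : ℕ} (A : GL (Fin n) ℂ), actMat g A = actMat h A := fun A =>
    congrArg (fun η => TensorAut.mat η A) hgh
  refine Prod.ext (MonoidHom.ext fun c => Units.ext ?_) ?_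
  · rw [← actMat_jordanGL_one, ← actMat_jordanGL_one, hm]
  · refine Multiplicative.toAdd.injective ?_
    rw [← actMat_jordanGL_two, ← actMat_jordanGL_two, hm]

/-- The preimage is read off the generators: `γ` from the rank one components, `t` from the upper
right entry on the block of size 2. -/
lemma actHom_surjective : Function.Surjective actHom := by
  intro η
  refine ⟨(TensorAut.character η, Multiplicative.ofAdd (TensorAut.mat η (jordanGL 1 2) 0 1)),
    TensorAut.ext_of_generators (fun c => ?_) ?_⟩
  · refine Matrix.ext fun i j => ?_
    rw [Subsingleton.elim i 0, Subsingleton.elim j 0]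
    exact actMat_jordanGL_one _ c
  · rw [TensorAut.mat_jordanGL_two (actHom _)]
    conv_rhs => rw [TensorAut.mat_jordanGL_two η]
    exact congrArg (fun x => !![1, x; 0, 1]) (actMat_jordanGL_two _)

/-- The identification of `ℤ^alg` with the tensor automorphisms of the forgetful functor. -/
noncomputable def actEquiv : ZAlg ≃* TensorAut :=
  MulEquiv.ofBijective actHom ⟨actHom_injective, actHom_surjective⟩

end Generators
end LocalGalois

namespace LocalGalois

open CategoryTheory MonoidalCategory

/-! ### Fibre functors at points of `ℂ^*`: Taylor coefficients and the coordinate `z`. -/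

section LocalFibres
open Filter Topology

lemma Continues.sigmaQ {g : MeroGerm} {f : ℂ → ℂ} (h : Continues g f) (q : ℂˣ) :
    Continues (LocalGalois.sigmaQ q g) (fun z => f (q * z)) := by
  refine ⟨fun z hz => ?_, ?_⟩
  · exact (h.1 _ (mul_ne_zero q.ne_zero hz)).fun_comp (by fun_prop)
  · obtain ⟨g, hg⟩ := g
    obtain ⟨hf, rfl⟩ := h
    rfl

lemma Continues.meromorphicAt {g : MeroGerm} {f : ℂ → ℂ} (h : Continues g f) :
    MeromorphicAt f 0 := by
  obtain ⟨f', hf', he⟩ := g.2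
  exact hf'.congr (Germ.coe_eq.1 (he.trans h.2.symm))

/-- The continuation of a germ becomes entire after multiplication by a power of `z`. -/
lemma Continues.exists_entire {g : MeroGerm} {f : ℂ → ℂ} (h : Continues g f) :
    ∃ n : ℕ, ∀ m, n ≤ m → Differentiable ℂ fun z => z ^ m * f z := by
  obtain ⟨n, hn⟩ := h.meromorphicAt
  refine ⟨n, fun m hm z => ?_⟩
  by_cases hz : z = 0
  · subst hz
    have e : (fun z : ℂ => z ^ m * f z) = fun z => z ^ (m - n) * ((z - 0) ^ n • f z) := by
      funext z
      rw [sub_zero, smul_eq_mul, ← mul_assoc, ← pow_add, Nat.sub_add_cancel hm]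
    rw [e]
    exact (AnalyticAt.mul (by fun_prop) hn).differentiableAt
  · exact (AnalyticAt.mul (by fun_prop) (h.1 z hz)).differentiableAt

/-- The functional equation of a morphism, for the continuations to `ℂ^*`. -/
lemma continues_functional_equation {q : ℂˣ} {X Y : FlatLocal q} (F : X ⟶ Y)
    {f : Fin Y.rank → Fin X.rank → ℂ → ℂ}
    (hf : ∀ i j, Continues (FlatSys.matrix F i j) (f i j)) {z : ℂ} (hz : z ≠ 0)
    (i : Fin Y.rank) (j : Fin X.rank) :
    ∑ k, f i k (q * z) * X.A.val k j = ∑ k, Y.A.val i k * f k j z := by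
  have hl : Continues (((FlatSys.matrix F).map (sigmaQ q) * constMat MeroGerm X.A.val) i j)
      (∑ k, (fun z => f i k (q * z)) * fun _ => X.A.val k j) := by
    rw [Matrix.mul_apply]
    exact Continues.sum _ fun k => ((hf i k).sigmaQ q).mul (Continues.const _)
  have hr : Continues ((constMat MeroGerm Y.A.val * FlatSys.matrix F) i j)
      (∑ k, (fun _ => Y.A.val i k) * f k j) := by
    rw [Matrix.mul_apply]
    exact Continues.sum _ fun k => (Continues.const _).mul (hf k j)
  have hc : (FlatSys.matrix F).map (sigmaQ q) * constMat MeroGerm X.A.val =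
      constMat MeroGerm Y.A.val * FlatSys.matrix F := F.comm
  rw [hc] at hl
  simpa [Finset.sum_apply] using hl.unique hr hz

/-- An entire solution of `G(qz) A = q^M B G(z)` intertwines the actions of `(γ, t)`, up to the
factor `γ(q)^M`, when its argument is multiplied by `γ(q)`. -/
lemma entire_intertwine {q : ℂˣ} {n p : ℕ} {A : GL (Fin n) ℂ} {B : GL (Fin p) ℂ} {M : ℕ}
    {G : Fin p → Fin n → ℂ → ℂ} (hG : ∀ i j, Differentiable ℂ (G i j))
    (h : ∀ z i j, ∑ k, G i k (q * z) * A.val k j = (q : ℂ) ^ M * ∑ k, B.val i k * G k j z)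
    (g : ZAlg) (z : ℂ) (i : Fin p) (j : Fin n) :
    ∑ k, G i k (g.1 q * z) * actMat g A k j =
      (g.1 q : ℂ) ^ M * ∑ k, actMat g B i k * G k j z := by
  let a : ℕ → Matrix (Fin p) (Fin n) ℂ := fun m => Matrix.of fun i j => iteratedDeriv m (G i j) 0
  have hsmooth : ∀ i j (m : ℕ), ContDiff ℂ m (G i j) := fun i j m => (hG i j).contDiff
  -- Differentiating the functional equation `m` times at `0` brings out `q^m` on the left: each
  -- Taylor coefficient is a constant intertwiner from `q^m A` to `q^M B`.
  have ha : ∀ m, a m * (q ^ m • A).val = (q ^ M • B).val * a m := by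
    intro m
    ext i j
    have h1 := congrArg (fun u : ℂ → ℂ => iteratedDeriv m u 0) (funext fun z => h z i j)
    beta_reduce at h1
    rw [iteratedDeriv_fun_sum, iteratedDeriv_const_mul_field, iteratedDeriv_fun_sum] at h1
    · simp only [iteratedDeriv_mul_const_field, iteratedDeriv_const_mul_field,
        iteratedDeriv_comp_const_mul (hsmooth _ _ m), mul_zero] at h1
      simp only [Units.val_smul, Units.smul_def, Units.val_pow_eq_pow_val,
        Matrix.smul_apply, Matrix.mul_apply, smul_eq_mul, a, Matrix.of_apply]
      simp only [mul_assoc, ← Finset.mul_sum]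
      rw [← h1]
      exact Finset.sum_congr rfl fun k _ => by ring
    · exact fun k _ => (contDiff_const.mul (hsmooth k j m)).contDiffAt
    · exact fun k _ =>
        (((hsmooth i k m).comp (contDiff_const.mul contDiff_id)).mul contDiff_const).contDiffAt
  have ha' : ∀ m, (g.1 q : ℂ) ^ m * (a m * actMat g A) i j =
      (g.1 q : ℂ) ^ M * (actMat g B * a m) i j := by
    intro m
    have h1 := actMat_intertwine (ha m) g
    rw [actMat_smul, actMat_smul, map_pow, map_pow, Matrix.mul_smul, Matrix.smul_mul] at h1
    simpa using congrFun (congrFun h1 i) j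
  have hl : HasSum (fun m : ℕ => ∑ k, ((m.factorial : ℂ)⁻¹ • ((g.1 q * z) - 0) ^ m • a m i k) *
      actMat g A k j) (∑ k, G i k (g.1 q * z) * actMat g A k j) :=
    hasSum_sum fun k _ => (Complex.hasSum_taylorSeries_of_entire (hG i k) 0 _).mul_right _
  have hr : HasSum (fun m : ℕ => (g.1 q : ℂ) ^ M * ∑ k, actMat g B i k *
      ((m.factorial : ℂ)⁻¹ • (z - 0) ^ m • a m k j))
      ((g.1 q : ℂ) ^ M * ∑ k, actMat g B i k * G k j z) :=
    (hasSum_sum fun k _ =>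
      (Complex.hasSum_taylorSeries_of_entire (hG k j) 0 _).mul_left _).mul_left _
  -- By `ha'` the Taylor series of both sides agree term by term, the factor `γ(q)^m` being absorbed
  -- by the argument `γ(q) z`.
  refine hl.unique ?_
  convert hr using 2 with m
  have h2 := ha' m
  simp only [Matrix.mul_apply] at h2
  calc _ = (m.factorial : ℂ)⁻¹ * z ^ m *
        ((g.1 q : ℂ) ^ m * ∑ k, a m i k * actMat g A k j) := by
        rw [Finset.mul_sum, Finset.mul_sum]
        refine Finset.sum_congr rfl fun k _ => ?_
        simp only [sub_zero, smul_eq_mul, mul_pow]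
        ring
    _ = _ := by
        rw [h2, Finset.mul_sum, Finset.mul_sum, Finset.mul_sum]
        refine Finset.sum_congr rfl fun k _ => ?_
        simp only [sub_zero, smul_eq_mul]
        ring

/-- The pairs `(γ, t)` with `γ(q) z₀ = z₁` intertwine the values at `z₀` and `z₁` of the morphisms
of flat systems. -/
lemma fibre_intertwine {q : ℂˣ} (hq : 1 < ‖(q : ℂ)‖) {z₀ z₁ : ℂˣ} {g : ZAlg}
    (hg : g.1 q * z₀ = z₁) {X Y : FlatLocal q} (F : X ⟶ Y) :
    (FlatSys.matrix F).map (germEval · z₁) * actMat g X.A =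
      actMat g Y.A * (FlatSys.matrix F).map (germEval · z₀) := by
  obtain ⟨f, hf⟩ := exists_continues hq F
  choose n hn using fun i j => (hf i j).exists_entire
  -- One exponent clears the poles of all entries. The extra `1` makes `M` positive, so that `z^M`
  -- vanishes at `0` and the functional equation holds there whatever the continuations are at `0`.
  let M := ∑ i, ∑ j, n i j + 1
  have hM : ∀ i j, n i j ≤ M := fun i j =>
    ((Finset.single_le_sum (f := fun j => n i j) (fun _ _ => Nat.zero_le _)
      (Finset.mem_univ j)).trans (Finset.single_le_sum (f := fun i => ∑ j, n i j)
      (fun _ _ => Nat.zero_le _) (Finset.mem_univ i))).trans (Nat.le_succ _)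
  have hM0 : M ≠ 0 := Nat.succ_ne_zero _
  have hfun : ∀ z i j, ∑ k, ((q * z) ^ M * f i k (q * z)) * X.A.val k j =
      (q : ℂ) ^ M * ∑ k, Y.A.val i k * (z ^ M * f k j z) := by
    intro z i j
    by_cases hz : z = 0
    · simp [hz, hM0]
    · calc _ = (q : ℂ) ^ M * z ^ M * ∑ k, f i k (q * z) * X.A.val k j := by
            rw [Finset.mul_sum]
            exact Finset.sum_congr rfl fun k _ => by rw [mul_pow]; ring
        _ = _ := by
            rw [continues_functional_equation F hf hz, Finset.mul_sum, Finset.mul_sum]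
            exact Finset.sum_congr rfl fun k _ => by ring
  have key := entire_intertwine (G := fun i j z => z ^ M * f i j z)
    (fun i j => hn i j M (hM i j)) hfun g z₀
  have hz : (g.1 q : ℂ) * z₀ = z₁ := by rw [← Units.val_mul, hg]
  ext i j
  have h1 := key i j
  simp only [hz] at h1
  have hne : (z₁ : ℂ) ^ M ≠ 0 := pow_ne_zero _ z₁.ne_zero
  -- The auxiliary powers cancel because `z₁^M = γ(q)^M z₀^M`.
  refine mul_left_cancel₀ hne ?_
  simp only [Matrix.mul_apply, Matrix.map_apply]
  calc _ = ∑ k, (z₁ : ℂ) ^ M * f i k z₁ * actMat g X.A k j := by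
        rw [Finset.mul_sum]
        exact Finset.sum_congr rfl fun k _ => by rw [(hf i k).eval z₁.ne_zero, mul_assoc]
    _ = _ := by
        rw [h1, Finset.mul_sum, Finset.mul_sum, ← hz]
        exact Finset.sum_congr rfl fun k _ => by
          rw [(hf k j).eval z₀.ne_zero, mul_pow]
          ring

/-- The tensor isomorphism of fibre functors defined by a pair `(γ, t)` with `γ(q) z₀ = z₁`. -/
noncomputable def fibreIso {q : ℂˣ} (hq : 1 < ‖(q : ℂ)‖) {z₀ z₁ : ℂˣ} (g : ZAlg)
    (hg : g.1 q * z₀ = z₁) : TensorIso q hq z₀ z₁ :=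
  LaxMonoidalFunctor.isoOfComponents (fun X => actIso g X.A)
    (fun F => (fibre_intertwine hq hg F).symm)
    (by
      have h : actMat g (1 : GL (Fin 1) ℂ) * (1 : Matrix (Fin 1) (Fin 1) ℂ) = 1 := by
        rw [actMat_one_right, Matrix.one_mul]
      exact h)
    (fun X Y => by
      have h : actMat g (kronGL X.A Y.A) * 1 = 1 * kron (actMat g X.A) (actMat g Y.A) := by
        rw [actMat_kronGL, Matrix.one_mul, Matrix.mul_one]
      exact h)

lemma restrict_fibreIso {q : ℂˣ} (hq : 1 < ‖(q : ℂ)‖) {z₀ z₁ : ℂˣ} (g : ZAlg)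
    (hg : g.1 q * z₀ = z₁) : restrict q hq z₀ z₁ (fibreIso hq g hg) = actAut g :=
  TensorAut.ext_mat fun _ _ => rfl

/-- Every object of the flat local category comes from a representation of `ℤ`, so no component is
lost. -/
lemma restrict_injective (q : ℂˣ) (hq : 1 < ‖(q : ℂ)‖) (z₀ z₁ : ℂˣ) :
    Function.Injective (restrict q hq z₀ z₁) := by
  intro η θ h
  refine Iso.ext (LaxMonoidalFunctor.hom_ext (NatTrans.ext (funext fun X => ?_)))
  exact congrArg (fun α : TensorAut => α.hom.hom.app (⟨X.rank, X.A⟩ : RepZ)) h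

/-- The germ of the coordinate `z`. -/
noncomputable def coordGerm : MeroGerm :=
  ⟨((fun z : ℂ => z : ℂ → ℂ) : Germ (𝓝[≠] (0 : ℂ)) ℂ), _, MeromorphicAt.id 0, rfl⟩

lemma continues_coordGerm : Continues coordGerm fun z => z :=
  ⟨fun _ _ => analyticAt_id, rfl⟩

lemma sigmaQ_coordGerm (q : ℂˣ) :
    sigmaQ q coordGerm = algebraMap ℂ MeroGerm q * coordGerm := rfl

/-- Multiplication by `z`, as a morphism `(ℂ, 1) → (ℂ, q)`. -/
noncomputable def coordHom (q : ℂˣ) : (⟨1, 1⟩ : FlatLocal q) ⟶ ⟨1, jordanGL q 1⟩ :=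
  FlatSys.Hom.mk (Matrix.of fun _ _ => coordGerm) (by
    refine Matrix.ext fun i j => ?_
    have hi : i = 0 := Subsingleton.elim (α := Fin 1) _ _
    have hj : j = 0 := Subsingleton.elim (α := Fin 1) _ _
    subst hi hj
    simp [Matrix.mul_apply, constMat, jordanGL_val, jordan, sigmaQ_coordGerm])

/-- Naturality for the morphism `z : (ℂ, 1) → (ℂ, q)`, whose values in the two fibres are `z₀` and
`z₁`, together with the trivial component on the unit. -/
lemma TensorIso.character_mul {q : ℂˣ} {hq : 1 < ‖(q : ℂ)‖} {z₀ z₁ : ℂˣ}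
    (η : TensorIso q hq z₀ z₁) :
    TensorAut.mat (restrict q hq z₀ z₁ η) (jordanGL q 1) 0 0 * z₀ = z₁ := by
  have h : TensorAut.mat (restrict q hq z₀ z₁ η) (jordanGL q 1) *
      (Matrix.of fun _ _ => coordGerm : Matrix (Fin 1) (Fin 1) MeroGerm).map (germEval · z₀) =
      (Matrix.of fun _ _ => coordGerm : Matrix (Fin 1) (Fin 1) MeroGerm).map (germEval · z₁) *
        TensorAut.mat (restrict q hq z₀ z₁ η) 1 := η.hom.hom.naturality (coordHom q)
  rw [TensorAut.mat_one, Matrix.mul_one] at h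
  have h0 := congrFun (congrFun h 0) 0
  simpa [Matrix.mul_apply, continues_coordGerm.eval z₀.ne_zero,
    continues_coordGerm.eval z₁.ne_zero] using h0

end LocalFibres
end LocalGalois

/-- The tensor automorphisms of the forgetful functor on representations of `ℤ` are identified by
`e` with `ℤ^alg`, the pair `(γ, t)` acting on `(ℂ^n, A)` by `γ(A_s) A_u^t`; restriction to the
representations of `ℤ` realizes `Iso^⊗(ω_{z₀}, ω_{z₁})` as the set of the pairs with
`γ(q) z₀ = z₁`. -/
theorem mainTheorem1 (q : ℂˣ) (hq : 1 < ‖(q : ℂ)‖) :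
    ∃ e : LocalGalois.ZAlg ≃* LocalGalois.TensorAut,
      (∀ (g : LocalGalois.ZAlg) (X : LocalGalois.RepZ) (D : LocalGalois.Dunford X.A),
        (e g).hom.hom.app X = D.act g) ∧
      ∀ z₀ z₁ : ℂˣ,
        Function.Injective (LocalGalois.restrict q hq z₀ z₁) ∧
        Set.range (LocalGalois.restrict q hq z₀ z₁) =
          e '' {g : LocalGalois.ZAlg | g.1 q * z₀ = z₁} := by
  refine ⟨LocalGalois.actEquiv, fun g X D => (D.act_eq_actMat g).symm, fun z₀ z₁ =>
    ⟨LocalGalois.restrict_injective q hq z₀ z₁, Set.Subset.antisymm ?_ ?_⟩⟩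
  · rintro _ ⟨η, rfl⟩
    obtain ⟨g, hg⟩ := LocalGalois.actEquiv.surjective (LocalGalois.restrict q hq z₀ z₁ η)
    refine ⟨g, Units.ext ?_, hg⟩
    have h := LocalGalois.TensorIso.character_mul η
    rw [← hg] at h
    rw [Units.val_mul, ← LocalGalois.actMat_jordanGL_one]
    exact h
  · rintro _ ⟨g, hg, rfl⟩
    exact ⟨LocalGalois.fibreIso hq g hg, LocalGalois.restrict_fibreIso hq g hg⟩
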